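/- A finite set of points in the plane is in general position if no three of its points are collinear and no four are cocircular. For a finite set $S$ of points in the plane and $A\subseteq S$, let $V_S(A)$ be the set of all points $x$ of the plane such that every point of $A$ is at least as close to $x$ as every point of $S\setminus A$. The edges of the order-$k$ Voronoi diagram of $S$ are the sets $V_S(A)\cap V_S(B)$ with $A\neq B$ subsets of $S$ of size $k$ that contain more than one point. For $P\subseteq S$ let $b_k(S,P)$ be the number of lines that are the perpendicular bisector of two distinct points of $P$ and that contain exactly four edges of the order-$k$ Voronoi diagram of $S$, and let $b_k=b_k(S,S)$. There are a constant $C$ and a function $\varepsilon:\mathbb N\to\mathbb R$ with $\varepsilon(n)=o(n)$ such that for every $n$ there is a set $S$ of $n$ points in general position in the plane with $$\sum_{k=1}^{\lfloor 2n/7\rfloor} b_k\ \ge\ \frac{4n}{7}-\varepsilon(n)\qquad\text{and}\qquad b_k\ne 0\ \text{ for at least }\ \frac n6-\varepsilon(n)\ \text{ values of } k.$$ Moreover, only $O(\log n)$ points of $S$ are needed to define these bisectors: there is a subset $P\subseteq S$ with $|P|\le C\log n$ (with $\log 0=0$) such that both bounds already hold with $b_k(S,P)$ in place of $b_k$. 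-/

import Mathlib

open Filter Asymptotics

/-- The Euclidean plane. -/
abbrev Plane : Type := EuclideanSpace ℝ (Fin 2)

/-- A finite point set is in general position if it contains neither three collinear points nor
four cocircular points. -/
def InGeneralPosition (S : Finset Plane) : Prop :=
  (∀ t : Finset Plane, t ⊆ S → t.card = 3 → ¬ Collinear ℝ (t : Set Plane)) ∧
  (∀ t : Finset Plane, t ⊆ S → t.card = 4 → ¬ EuclideanGeometry.Cospherical (t : Set Plane))

/-- The (closed) Voronoi cell of a subset `A` of `S`: the points `x` of the plane such that every
point of `A` is at least as close to `x` as every point of `S` outside `A`. The order-`k` Voronoi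
diagram of `S` consists of these cells for the subsets `A` with `k` elements. -/
def voronoiCell (S A : Finset Plane) : Set Plane :=
  {x | ∀ a ∈ A, ∀ s ∈ S, s ∉ A → dist x a ≤ dist x s}

/-- `e` is an edge of the order-`k` Voronoi diagram of `S`: the common boundary of two
different cells of the diagram, provided that it does not degenerate to a point or the empty set
(for `S` in general position, it is then a segment, a ray or a line). -/
def IsVoronoiEdge (S : Finset Plane) (k : ℕ) (e : Set Plane) : Prop :=
  ∃ A B : Finset Plane, A ⊆ S ∧ B ⊆ S ∧ A.card = k ∧ B.card = k ∧ A ≠ B ∧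
    e = voronoiCell S A ∩ voronoiCell S B ∧ e.Nontrivial

/-- The number of edges of the order-`k` Voronoi diagram of `S` that lie on the line `l`. -/
noncomputable def edgesOnLine (S : Finset Plane) (k : ℕ) (l : AffineSubspace ℝ Plane) : ℕ :=
  {e : Set Plane | IsVoronoiEdge S k e ∧ e ⊆ (l : Set Plane)}.ncard

/-- The number of perpendicular bisectors of two points of `P` that contribute with exactly four
edges to the order-`k` Voronoi diagram of `S`. For `P = S` this is the number `b_k` of `S`. -/
noncomputable def fourEdgeBisectors (S P : Finset Plane) (k : ℕ) : ℕ :=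
  {l : AffineSubspace ℝ Plane | (∃ p ∈ P, ∃ q ∈ P, p ≠ q ∧ l = AffineSubspace.perpBisector p q) ∧
    edgesOnLine S k l = 4}.ncard

/-!
The set `S` consists of the origin, six *partners* `q` near the upper vertical axis, and four large
groups of points. The perpendicular bisector of `0` and `q` is parametrized by `t`; a third point
`s` lies inside the circle through `0` and `q` centred at the point with parameter `t` exactly if
its power, an affine function of `t`, is negative. In general position each edge of order `k` on
the bisector corresponds to a set of `k - 1` points that is the full set of points inside one of
these circles (`InGeneralPosition.edgesOnLine_eq`). So the edges of order `k` are the visits to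
height `k - 1` of the walk that counts the points inside the circle as `t` runs over the line.

The groups are placed such that, for each of the six bisectors, the first group leaves the circle,
then the second enters, the third leaves and the fourth enters, while the other partners move in or
out only before or after all of this. With three groups of `h` points and a fourth one that is at
least as large, the walk goes down, up, down and up again, through all heights between about `h`
and `2 * h`, and stays above them at both ends. Hence these heights are visited exactly four times
(`ncard_negAt_eq_four`). With `h` about `n / 6`, all orders between `n / 6` and `n / 3`, up to a
constant, have `b_k ≥ 6`. This gives `n / 6` orders with `b_k ≠ 0`, and the orders up to `2 * n / 7`
contribute `6 * (2 / 7 - 1 / 6) * n = 5 * n / 7`, which exceeds `4 * n / 7`. Only seven points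
define these bisectors.

All conditions on the positions are strict inequalities between continuous functions, so they hold
for points in small discs around a model configuration (`exists_radius`), in which general position
can be attained (`InGeneralPosition.exists_extension`).
-/

/-! ### Point sets in general position -/

lemma inGeneralPosition_empty : InGeneralPosition ∅ := by
  constructor <;> intro t ht hc <;> rw [Finset.subset_empty.mp ht] at hc <;> simp at hc

lemma inGeneralPosition_singleton (p : Plane) : InGeneralPosition {p} := by
  constructor <;> intro t ht hc <;> have := Finset.card_le_card ht <;> simp at this <;> omega

lemma measure_affineSpan_pair_eq_zero (t : Finset Plane) (ht : t.card = 2) :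
    MeasureTheory.volume (affineSpan ℝ (t : Set Plane) : Set Plane) = 0 := by
  apply MeasureTheory.Measure.addHaar_affineSubspace
  intro h
  obtain ⟨a, b, -, rfl⟩ := Finset.card_eq_two.mp ht
  have h1 := collinear_pair ℝ a b
  rw [collinear_iff_finrank_le_one, ← direction_affineSpan] at h1
  rw [Finset.coe_pair] at h
  rw [h, AffineSubspace.direction_top] at h1
  simp at h1

/-- The points cocircular with three given non-collinear points form a circle, hence a null set. -/
lemma measure_cospherical_eq_zero (t : Finset Plane) (ht : t.card = 3)
    (hc : ¬ Collinear ℝ (t : Set Plane)) :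
    MeasureTheory.volume
      {x : Plane | EuclideanGeometry.Cospherical (insert x (t : Set Plane))} = 0 := by
  obtain ⟨a, b, c, -, -, -, rfl⟩ := Finset.card_eq_three.mp ht
  have hind : AffineIndependent ℝ ![a, b, c] := by
    rw [affineIndependent_iff_not_collinear_set]
    simpa using hc
  let T : Affine.Simplex ℝ Plane 2 := ⟨![a, b, c], hind⟩
  refine MeasureTheory.measure_mono_null (t := Metric.sphere T.circumcenter T.circumradius) ?_
    (MeasureTheory.Measure.addHaar_sphere _ _ _)
  intro x hx
  obtain ⟨ctr, r, hr⟩ := hx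
  have hT : ∀ i, dist (T.points i) ctr = r := by
    intro i
    apply hr
    fin_cases i <;> simp [T]
  have hctr : ctr ∈ affineSpan ℝ (Set.range T.points) := by
    have : affineSpan ℝ (Set.range T.points) = ⊤ :=
      hind.affineSpan_eq_top_iff_card_eq_finrank_add_one.mpr (by simp)
    rw [this]; trivial
  have h1 := T.eq_circumcenter_of_dist_eq hctr hT
  have h2 := T.eq_circumradius_of_dist_eq hctr hT
  rw [← h1, ← h2]
  exact hr x (Set.mem_insert _ _)

/-- A point of a given nonempty open set can be added to a set in general position: the forbidden
positions lie on finitely many lines and circles. -/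
lemma InGeneralPosition.exists_insert {S : Finset Plane} (hS : InGeneralPosition S)
    {U : Set Plane} (hU : IsOpen U) (hne : U.Nonempty) :
    ∃ x ∈ U, x ∉ S ∧ InGeneralPosition (insert x S) := by
  classical
  set L : Set Plane := ⋃ t ∈ S.powersetCard 2, (affineSpan ℝ (t : Set Plane) : Set Plane) with hL
  set K : Set Plane := ⋃ t ∈ S.powersetCard 3,
    {x : Plane | EuclideanGeometry.Cospherical (insert x (t : Set Plane))} with hK
  have hL0 : MeasureTheory.volume L = 0 := by
    refine (MeasureTheory.measure_biUnion_null_iff (Finset.countable_toSet (S.powersetCard 2))).mpr ?_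
    intro t ht
    exact measure_affineSpan_pair_eq_zero t (Finset.mem_powersetCard.mp ht).2
  have hK0 : MeasureTheory.volume K = 0 := by
    refine (MeasureTheory.measure_biUnion_null_iff (Finset.countable_toSet (S.powersetCard 3))).mpr ?_
    intro t ht
    have ht' := Finset.mem_powersetCard.mp ht
    exact measure_cospherical_eq_zero t ht'.2 (hS.1 t ht'.1 ht'.2)
  have hS0 : MeasureTheory.volume (S : Set Plane) = 0 := S.finite_toSet.measure_zero _
  have hbad : MeasureTheory.volume ((S : Set Plane) ∪ L ∪ K) = 0 :=
    MeasureTheory.measure_union_null (MeasureTheory.measure_union_null hS0 hL0) hK0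
  obtain ⟨x, hxU, hx⟩ : ∃ x ∈ U, x ∉ (S : Set Plane) ∪ L ∪ K := by
    by_contra! hcon
    exact (hU.measure_pos MeasureTheory.volume hne).ne'
      (MeasureTheory.measure_mono_null (fun x hx => hcon x hx) hbad)
  simp only [Set.mem_union, not_or] at hx
  obtain ⟨⟨hxS, hxL⟩, hxK⟩ := hx
  refine ⟨x, hxU, by simpa using hxS, ?_, ?_⟩
  · intro t ht hcard hcol
    by_cases hxt : x ∈ t
    · apply hxL
      have hsub : t.erase x ⊆ S := Finset.subset_insert_iff.mp ht
      have hc2 : (t.erase x).card = 2 := by rw [Finset.card_erase_of_mem hxt, hcard]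
      refine Set.mem_biUnion (Finset.mem_coe.mpr (Finset.mem_powersetCard.mpr ⟨hsub, hc2⟩)) ?_
      obtain ⟨a, b, hab, he⟩ := Finset.card_eq_two.mp hc2
      have hmem : ∀ y ∈ ({a, b} : Finset Plane), y ∈ t := fun y hy => by
        rw [← he] at hy
        exact Finset.mem_of_mem_erase hy
      rw [he]
      simpa using hcol.mem_affineSpan_of_mem_of_ne (p₁ := a) (p₂ := b) (p₃ := x)
        (hmem a (by simp)) (hmem b (by simp)) hxt hab
    · exact hS.1 t ((Finset.subset_insert_iff_of_notMem hxt).mp ht) hcard hcol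
  · intro t ht hcard hcos
    by_cases hxt : x ∈ t
    · apply hxK
      have hsub : t.erase x ⊆ S := Finset.subset_insert_iff.mp ht
      have hc3 : (t.erase x).card = 3 := by rw [Finset.card_erase_of_mem hxt, hcard]
      refine Set.mem_biUnion (Finset.mem_coe.mpr (Finset.mem_powersetCard.mpr ⟨hsub, hc3⟩)) ?_
      rw [Set.mem_ofPred_eq, ← Finset.coe_insert, Finset.insert_erase hxt]
      exact hcos
    · exact hS.2 t ((Finset.subset_insert_iff_of_notMem hxt).mp ht) hcard hcos

/-- A set in general position can be extended by a family of points lying in prescribed nonempty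
open sets. -/
lemma InGeneralPosition.exists_extension {S : Finset Plane} (hS : InGeneralPosition S)
    {ι : Type*} [Fintype ι] (U : ι → Set Plane) (hU : ∀ i, IsOpen (U i))
    (hne : ∀ i, (U i).Nonempty) :
    ∃ f : ι → Plane, (∀ i, f i ∈ U i) ∧ Function.Injective f ∧ (∀ i, f i ∉ S) ∧
      InGeneralPosition (S ∪ Finset.univ.image f) := by
  classical
  have key : ∀ J : Finset ι, ∃ f : ι → Plane, (∀ i ∈ J, f i ∈ U i) ∧ Set.InjOn f J ∧
      (∀ i ∈ J, f i ∉ S) ∧ InGeneralPosition (S ∪ J.image f) := by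
    intro J
    induction J using Finset.induction_on with
    | empty => exact ⟨fun _ => 0, by simpa using hS⟩
    | insert j J hj ih =>
      obtain ⟨f, hf1, hf2, hf3, hf4⟩ := ih
      obtain ⟨x, hxU, hxS, hx⟩ := hf4.exists_insert (hU j) (hne j)
      rw [Finset.mem_union, not_or] at hxS
      have heq : ∀ i ∈ J, Function.update f j x i = f i := fun i hi =>
        Function.update_of_ne (ne_of_mem_of_not_mem hi hj) _ _
      have himg : J.image (Function.update f j x) = J.image f := Finset.image_congr heq
      refine ⟨Function.update f j x, ?_, ?_, ?_, ?_⟩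
      · intro i hi
        rcases Finset.mem_insert.mp hi with rfl | hi
        · simpa using hxU
        · rw [heq i hi]; exact hf1 i hi
      · rw [Finset.coe_insert, Set.injOn_insert (by simpa using hj)]
        refine ⟨fun a ha b hb hab => hf2 ha hb ?_, ?_⟩
        · rwa [heq a ha, heq b hb] at hab
        · rw [Function.update_self, ← Finset.coe_image, himg]
          exact_mod_cast hxS.2
      · intro i hi
        rcases Finset.mem_insert.mp hi with rfl | hi
        · simpa using hxS.1
        · rw [heq i hi]; exact hf3 i hi
      · rw [Finset.image_insert, himg, Function.update_self, Finset.union_insert]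
        exact hx
  obtain ⟨f, h1, h2, h3, h4⟩ := key Finset.univ
  exact ⟨f, fun i => h1 i (Finset.mem_univ i), fun a b h => h2 (by simp) (by simp) h,
    fun i => h3 i (Finset.mem_univ i), h4⟩

lemma exists_inGeneralPosition_card (n : ℕ) :
    ∃ S : Finset Plane, S.card = n ∧ InGeneralPosition S := by
  obtain ⟨f, -, hf, -, h⟩ := inGeneralPosition_empty.exists_extension (ι := Fin n)
    (fun _ => Set.univ) (fun _ => isOpen_univ) (fun _ => Set.univ_nonempty)
  refine ⟨_, ?_, h⟩
  rw [Finset.empty_union, Finset.card_image_of_injective _ hf, Finset.card_univ, Fintype.card_fin]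

/-! ### Signs of families of affine functions -/

/-- The members of a finite family of affine functions `t ↦ a s + b s * t` that are negative
at `t`. -/
noncomputable def negAt {α : Type*} (X : Finset α) (a b : α → ℝ) (t : ℝ) : Finset α :=
  X.filter fun s => a s + b s * t < 0

lemma mem_negAt {α : Type*} {X : Finset α} {a b : α → ℝ} {t : ℝ} {s : α} :
    s ∈ negAt X a b t ↔ s ∈ X ∧ a s + b s * t < 0 := Finset.mem_filter

/-- For distinct reals `ρ s` in an interval, a threshold in that interval can be chosen to have any
prescribed number of them below it. -/
lemma exists_threshold {α : Type*} (G : Finset α) (ρ : α → ℝ) {T T' : ℝ} (hT : T < T')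
    (hρ : ∀ s ∈ G, T < ρ s ∧ ρ s < T') (hinj : Set.InjOn ρ G) (m : ℕ) (hm : m ≤ G.card) :
    ∃ t, T < t ∧ t < T' ∧ (∀ s ∈ G, ρ s ≠ t) ∧ (G.filter fun s => ρ s < t).card = m := by
  classical
  induction G using Finset.induction_on_max_value ρ generalizing T' m with
  | empty =>
    obtain ⟨t, h1, h2⟩ := exists_between hT
    exact ⟨t, h1, h2, by simp, by simp at hm ⊢; omega⟩
  | insert s G hs hmax ih =>
    have hG : ∀ x ∈ G, ρ x < ρ s := fun x hx => lt_of_le_of_ne (hmax x hx) fun h =>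
      hs ((hinj (by simp [hx]) (by simp) h) ▸ hx)
    have hsT := hρ s (by simp)
    rw [Finset.card_insert_of_notMem hs] at hm
    rcases Nat.lt_or_ge G.card m with hlt | hle
    · obtain ⟨t, h1, h2⟩ := exists_between hsT.2
      have hall : ∀ x ∈ insert s G, ρ x < t := by
        intro x hx
        rcases Finset.mem_insert.mp hx with rfl | hx
        · exact h1
        · exact (hG x hx).trans h1
      refine ⟨t, hsT.1.trans h1, h2, fun x hx => (hall x hx).ne, ?_⟩
      rw [Finset.filter_true_of_mem hall, Finset.card_insert_of_notMem hs]
      omega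
    · obtain ⟨t, h1, h2, h3, h4⟩ := ih hsT.1
        (fun x hx => ⟨(hρ x (by simp [hx])).1, hG x hx⟩) (hinj.mono (by simp)) m hle
      refine ⟨t, h1, h2.trans hsT.2, ?_, ?_⟩
      · intro x hx
        rcases Finset.mem_insert.mp hx with rfl | hx
        · exact h2.ne'
        · exact h3 x hx
      · rw [Finset.filter_insert, if_neg h2.not_gt, h4]

/-- A value of an affine function inside an interval is negative if both end values are. -/
lemma affine_neg_of_neg {a b T T' t : ℝ} (h : T ≤ t) (h' : t ≤ T') (h1 : a + b * T < 0)
    (h2 : a + b * T' < 0) : a + b * t < 0 := by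
  rcases le_total 0 b with hb | hb
  · nlinarith [mul_le_mul_of_nonneg_left h' hb]
  · nlinarith [mul_le_mul_of_nonpos_left h hb]

lemma affine_pos_of_pos {a b T T' t : ℝ} (h : T ≤ t) (h' : t ≤ T') (h1 : 0 < a + b * T)
    (h2 : 0 < a + b * T') : 0 < a + b * t := by
  rcases le_total 0 b with hb | hb
  · nlinarith [mul_le_mul_of_nonneg_left h hb]
  · nlinarith [mul_le_mul_of_nonpos_left h' hb]

/-- If on `[T, T']` the only sign changes are those of the members of `G`, from positive to
negative and one at a time, then `negAt` takes each intermediate cardinality, and for only one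
set. -/
lemma exists_unique_negAt_of_enter {α : Type*} (X G : Finset α) (a b : α → ℝ) {T T' : ℝ}
    (hT : T < T') (hGX : G ⊆ X)
    (hG : ∀ s ∈ G, 0 < a s + b s * T ∧ a s + b s * T' < 0)
    (hX : ∀ s ∈ X, s ∉ G → (a s + b s * T < 0 ∧ a s + b s * T' < 0) ∨
      (0 < a s + b s * T ∧ 0 < a s + b s * T'))
    (hroot : ∀ s ∈ X, ∀ s' ∈ X, ∀ t, a s + b s * t = 0 → a s' + b s' * t = 0 → s = s')
    {r : ℕ} (h1 : (negAt X a b T).card < r) (h2 : r < (negAt X a b T').card) :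
    ∃ t₀, T ≤ t₀ ∧ t₀ ≤ T' ∧ (∀ s ∈ X, a s + b s * t₀ ≠ 0) ∧ (negAt X a b t₀).card = r ∧
      (∃ s ∈ G, s ∈ negAt X a b t₀) ∧ (∃ s ∈ G, s ∉ negAt X a b t₀) ∧
      ∀ t, T ≤ t → t ≤ T' → (negAt X a b t).card = r → negAt X a b t = negAt X a b t₀ := by
  classical
  have hb : ∀ s ∈ G, b s < 0 := fun s hs => by
    by_contra! hcon
    nlinarith [hG s hs, mul_le_mul_of_nonneg_left hT.le hcon]
  have hlt : ∀ s ∈ G, ∀ t, a s + b s * t < 0 ↔ -a s / b s < t := fun s hs t => by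
    rw [div_lt_iff_of_neg (hb s hs)]
    constructor <;> intro h <;> linarith
  have hzero : ∀ s ∈ G, a s + b s * (-a s / b s) = 0 := fun s hs => by
    have := (hb s hs).ne
    field_simp
    ring
  have hmono : ∀ t t', T ≤ t → t ≤ t' → t' ≤ T' → negAt X a b t ⊆ negAt X a b t' := by
    intro t t' h h' h'' s hs
    rw [mem_negAt] at hs ⊢
    refine ⟨hs.1, ?_⟩
    by_cases hsG : s ∈ G
    · rw [hlt s hsG] at hs ⊢
      exact hs.2.trans_le h'
    · rcases hX s hs.1 hsG with hn | hp
      · exact affine_neg_of_neg (h.trans h') h'' hn.1 hn.2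
      · exact absurd hs.2 (affine_pos_of_pos h (h'.trans h'') hp.1 hp.2).not_gt
  have hsplit : ∀ t, T ≤ t → t ≤ T' →
      negAt X a b t = negAt X a b T ∪ G.filter fun s => -a s / b s < t := by
    intro t h h'
    ext s
    rw [Finset.mem_union, Finset.mem_filter]
    constructor
    · intro hs
      by_cases hsG : s ∈ G
      · exact Or.inr ⟨hsG, (hlt s hsG t).mp (mem_negAt.mp hs).2⟩
      · rw [mem_negAt] at hs ⊢
        rcases hX s hs.1 hsG with hn | hp
        · exact Or.inl ⟨hs.1, hn.1⟩
        · exact absurd hs.2 (affine_pos_of_pos h h' hp.1 hp.2).not_gt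
    · rintro (hs | ⟨hsG, hs⟩)
      · exact hmono T t le_rfl h h' hs
      · exact mem_negAt.mpr ⟨hGX hsG, (hlt s hsG t).mpr hs⟩
  have hdisj : ∀ t, Disjoint (negAt X a b T) (G.filter fun s => -a s / b s < t) := by
    intro t
    rw [Finset.disjoint_left]
    intro s hs hs'
    exact (hG s (Finset.mem_filter.mp hs').1).1.not_gt (mem_negAt.mp hs).2
  have hcard : ∀ t, T ≤ t → t ≤ T' → (negAt X a b t).card =
      (negAt X a b T).card + (G.filter fun s => -a s / b s < t).card := fun t h h' => by
    rw [hsplit t h h', Finset.card_union_of_disjoint (hdisj t)]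
  have hrG : r - (negAt X a b T).card < G.card := by
    have := hcard T' hT.le le_rfl
    have := Finset.card_filter_le G fun s => -a s / b s < T'
    omega
  obtain ⟨t₀, ht1, ht2, ht3, ht4⟩ := exists_threshold G (fun s => -a s / b s) hT
    (fun s hs => ⟨by
      have := (hlt s hs T).not.mp (hG s hs).1.not_gt
      refine lt_of_le_of_ne (not_lt.mp this) fun h => ?_
      have := hzero s hs
      rw [← h] at this
      exact (hG s hs).1.ne' this, (hlt s hs T').mp (hG s hs).2⟩)
    (fun s hs s' hs' h => hroot s (hGX hs) s' (hGX hs') (-a s / b s) (hzero s hs) (by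
      simp only at h
      rw [h]; exact hzero s' hs')) (r - (negAt X a b T).card) hrG.le
  have hmem : ∀ s ∈ G, s ∈ negAt X a b t₀ ↔ -a s / b s < t₀ := fun s hs => by
    rw [mem_negAt, hlt s hs]
    exact ⟨fun h => h.2, fun h => ⟨hGX hs, h⟩⟩
  have hc₀ : (negAt X a b t₀).card = r := by
    rw [hcard t₀ ht1.le ht2.le, ht4]; omega
  refine ⟨t₀, ht1.le, ht2.le, ?_, hc₀, ?_, ?_, ?_⟩
  · intro s hs h0
    by_cases hsG : s ∈ G
    · refine ht3 s hsG ?_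
      have := (hb s hsG).ne
      rw [div_eq_iff this]
      linarith
    · rcases hX s hs hsG with hn | hp
      · exact (affine_neg_of_neg ht1.le ht2.le hn.1 hn.2).ne h0
      · exact (affine_pos_of_pos ht1.le ht2.le hp.1 hp.2).ne' h0
  · have : 0 < (G.filter fun s => -a s / b s < t₀).card := by omega
    obtain ⟨s, hs⟩ := Finset.card_pos.mp this
    rw [Finset.mem_filter] at hs
    exact ⟨s, hs.1, (hmem s hs.1).mpr hs.2⟩
  · by_contra! hcon
    have : (G.filter fun s => -a s / b s < t₀) = G :=
      Finset.filter_true_of_mem fun s hs => (hmem s hs).mp (hcon s hs)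
    rw [this] at ht4
    omega
  · intro t h h' hr
    rcases le_total t t₀ with hle | hle
    · exact Finset.eq_of_subset_of_card_le (hmono t t₀ h hle ht2.le) (by omega)
    · exact (Finset.eq_of_subset_of_card_le (hmono t₀ t ht1.le hle h') (by omega)).symm

/-- The mirror image of `exists_unique_negAt_of_enter`: the members of `G` change from negative
to positive. -/
lemma exists_unique_negAt_of_leave {α : Type*} (X G : Finset α) (a b : α → ℝ) {T T' : ℝ}
    (hT : T < T') (hGX : G ⊆ X)
    (hG : ∀ s ∈ G, a s + b s * T < 0 ∧ 0 < a s + b s * T')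
    (hX : ∀ s ∈ X, s ∉ G → (a s + b s * T < 0 ∧ a s + b s * T' < 0) ∨
      (0 < a s + b s * T ∧ 0 < a s + b s * T'))
    (hroot : ∀ s ∈ X, ∀ s' ∈ X, ∀ t, a s + b s * t = 0 → a s' + b s' * t = 0 → s = s')
    {r : ℕ} (h1 : (negAt X a b T').card < r) (h2 : r < (negAt X a b T).card) :
    ∃ t₀, T ≤ t₀ ∧ t₀ ≤ T' ∧ (∀ s ∈ X, a s + b s * t₀ ≠ 0) ∧ (negAt X a b t₀).card = r ∧
      (∃ s ∈ G, s ∈ negAt X a b t₀) ∧ (∃ s ∈ G, s ∉ negAt X a b t₀) ∧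
      ∀ t, T ≤ t → t ≤ T' → (negAt X a b t).card = r → negAt X a b t = negAt X a b t₀ := by
  have hneg : ∀ t, negAt X a (fun s => -b s) (-t) = negAt X a b t := fun t => by
    simp [negAt]
  obtain ⟨t₀, k1, k2, k3, k4, k5, k6, k7⟩ := exists_unique_negAt_of_enter X G a
    (fun s => -b s) (neg_lt_neg hT) hGX
    (fun s hs => by simpa using (hG s hs).symm)
    (fun s hs hs' => by simpa [and_comm] using hX s hs hs')
    (fun s hs s' hs' t h h' => hroot s hs s' hs' (-t) (by linarith) (by linarith))
    (r := r) (by rwa [hneg]) (by rwa [hneg])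
  have ht₀ : negAt X a (fun s => -b s) t₀ = negAt X a b (-t₀) := by rw [← hneg, neg_neg]
  rw [ht₀] at k4 k5 k6 k7
  refine ⟨-t₀, by linarith, by linarith, fun s hs => ?_, k4, k5, k6, fun t h h' hr => ?_⟩
  · have := k3 s hs
    rwa [neg_mul, ← mul_neg] at this
  · have := k7 (-t) (by linarith) (by linarith)
    rw [hneg] at this
    exact this hr

/-- Suppose that, apart from at most `c` functions without zeros in `[T₀, T₄]`, the family splits
into four groups with zeros in the consecutive intervals `(T₀, T₁)`, …, `(T₃, T₄)`, which
alternately leave and enter `negAt`. Then `negAt` takes every cardinality between `h + c` and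
`2h`, where `h` is a lower bound for the group sizes, attained by the two middle groups, for
exactly four different sets: one in each interval. -/
lemma ncard_negAt_eq_four {α : Type*} (X : Finset α) (a b : α → ℝ) (G₁ G₂ G₃ G₄ O : Finset α)
    {T₀ T₁ T₂ T₃ T₄ : ℝ} (h01 : T₀ < T₁) (h12 : T₁ < T₂) (h23 : T₂ < T₃) (h34 : T₃ < T₄)
    (hX : ∀ s, s ∈ X ↔ s ∈ G₁ ∨ s ∈ G₂ ∨ s ∈ G₃ ∨ s ∈ G₄ ∨ s ∈ O)
    (hG₁ : ∀ s ∈ G₁, a s + b s * T₀ < 0 ∧ 0 < a s + b s * T₁)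
    (hG₂ : ∀ s ∈ G₂, 0 < a s + b s * T₁ ∧ a s + b s * T₂ < 0)
    (hG₃ : ∀ s ∈ G₃, a s + b s * T₂ < 0 ∧ 0 < a s + b s * T₃)
    (hG₄ : ∀ s ∈ G₄, 0 < a s + b s * T₃ ∧ a s + b s * T₄ < 0)
    (hO : ∀ s ∈ O, (a s + b s * T₀ < 0 ∧ a s + b s * T₄ < 0) ∨
      (0 < a s + b s * T₀ ∧ 0 < a s + b s * T₄))
    (hroot : ∀ s ∈ X, ∀ s' ∈ X, ∀ t, a s + b s * t = 0 → a s' + b s' * t = 0 → s = s')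
    {h c r : ℕ} (hc₁ : h ≤ G₁.card) (hc₂ : G₂.card = h) (hc₃ : G₃.card = h) (hc₄ : h ≤ G₄.card)
    (hcO : O.card ≤ c) (hr1 : h + c < r) (hr2 : r < 2 * h) :
    {I : Finset α | ∃ t, (∀ s ∈ X, a s + b s * t ≠ 0) ∧ I = negAt X a b t ∧
      I.card = r}.ncard = 4 := by
  classical
  have hX₁ : G₁ ⊆ X := fun s hs => (hX s).mpr (by tauto)
  have hX₂ : G₂ ⊆ X := fun s hs => (hX s).mpr (by tauto)
  have hX₃ : G₃ ⊆ X := fun s hs => (hX s).mpr (by tauto)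
  have hX₄ : G₄ ⊆ X := fun s hs => (hX s).mpr (by tauto)
  -- An affine function that changes sign keeps its sign outside of the interval.
  have hb₁ : ∀ s ∈ G₁, 0 < b s := fun s hs => by
    by_contra! hb; nlinarith [hG₁ s hs, mul_le_mul_of_nonpos_left h01.le hb]
  have hb₂ : ∀ s ∈ G₂, b s < 0 := fun s hs => by
    by_contra! hb; nlinarith [hG₂ s hs, mul_le_mul_of_nonneg_left h12.le hb]
  have hb₃ : ∀ s ∈ G₃, 0 < b s := fun s hs => by
    by_contra! hb; nlinarith [hG₃ s hs, mul_le_mul_of_nonpos_left h23.le hb]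
  have hb₄ : ∀ s ∈ G₄, b s < 0 := fun s hs => by
    by_contra! hb; nlinarith [hG₄ s hs, mul_le_mul_of_nonneg_left h34.le hb]
  have l₁ : ∀ s ∈ G₁, ∀ t ≤ T₀, a s + b s * t < 0 := fun s hs t ht => by
    nlinarith [hG₁ s hs, mul_le_mul_of_nonneg_left ht (hb₁ s hs).le]
  have g₁ : ∀ s ∈ G₁, ∀ t, T₁ ≤ t → 0 < a s + b s * t := fun s hs t ht => by
    nlinarith [hG₁ s hs, mul_le_mul_of_nonneg_left ht (hb₁ s hs).le]
  have l₂ : ∀ s ∈ G₂, ∀ t ≤ T₁, 0 < a s + b s * t := fun s hs t ht => by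
    nlinarith [hG₂ s hs, mul_le_mul_of_nonpos_left ht (hb₂ s hs).le]
  have g₂ : ∀ s ∈ G₂, ∀ t, T₂ ≤ t → a s + b s * t < 0 := fun s hs t ht => by
    nlinarith [hG₂ s hs, mul_le_mul_of_nonpos_left ht (hb₂ s hs).le]
  have l₃ : ∀ s ∈ G₃, ∀ t ≤ T₂, a s + b s * t < 0 := fun s hs t ht => by
    nlinarith [hG₃ s hs, mul_le_mul_of_nonneg_left ht (hb₃ s hs).le]
  have g₃ : ∀ s ∈ G₃, ∀ t, T₃ ≤ t → 0 < a s + b s * t := fun s hs t ht => by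
    nlinarith [hG₃ s hs, mul_le_mul_of_nonneg_left ht (hb₃ s hs).le]
  have l₄ : ∀ s ∈ G₄, ∀ t ≤ T₃, 0 < a s + b s * t := fun s hs t ht => by
    nlinarith [hG₄ s hs, mul_le_mul_of_nonpos_left ht (hb₄ s hs).le]
  have g₄ : ∀ s ∈ G₄, ∀ t, T₄ ≤ t → a s + b s * t < 0 := fun s hs t ht => by
    nlinarith [hG₄ s hs, mul_le_mul_of_nonpos_left ht (hb₄ s hs).le]
  have gO : ∀ s ∈ O, ∀ t t', T₀ ≤ t → t ≤ T₄ → T₀ ≤ t' → t' ≤ T₄ →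
      (a s + b s * t < 0 ∧ a s + b s * t' < 0) ∨ (0 < a s + b s * t ∧ 0 < a s + b s * t') := by
    intro s hs t t' k1 k2 k3 k4
    rcases hO s hs with hn | hp
    · exact Or.inl ⟨affine_neg_of_neg k1 k2 hn.1 hn.2, affine_neg_of_neg k3 k4 hn.1 hn.2⟩
    · exact Or.inr ⟨affine_pos_of_pos k1 k2 hp.1 hp.2, affine_pos_of_pos k3 k4 hp.1 hp.2⟩
  -- The cardinalities at the five thresholds, and beyond the outer ones.
  have big : ∀ G G' : Finset α, ∀ t, G ⊆ X → G' ⊆ X → h ≤ G.card → h ≤ G'.card →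
      (∀ s ∈ G, a s + b s * t < 0) → (∀ s ∈ G', a s + b s * t < 0) →
      (∀ s ∈ G, s ∉ G') → r < (negAt X a b t).card := by
    intro G G' t k1 k2 k3 k4 k5 k6 k7
    have hsub : G ∪ G' ⊆ negAt X a b t := by
      intro s hs
      rw [mem_negAt]
      rcases Finset.mem_union.mp hs with hs | hs
      · exact ⟨k1 hs, k5 s hs⟩
      · exact ⟨k2 hs, k6 s hs⟩
    have := Finset.card_le_card hsub
    rw [Finset.card_union_of_disjoint (Finset.disjoint_left.mpr k7)] at this
    omega
  have small : ∀ G : Finset α, ∀ t, G.card = h → (∀ s ∈ negAt X a b t, s ∈ G ∨ s ∈ O) →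
      (negAt X a b t).card < r := by
    intro G t k1 k2
    have hsub : negAt X a b t ⊆ G ∪ O := fun s hs => Finset.mem_union.mpr (k2 s hs)
    have := Finset.card_le_card hsub
    have := Finset.card_union_le G O
    omega
  have c₀ : ∀ t ≤ T₀, r < (negAt X a b t).card := fun t ht =>
    big G₁ G₃ t hX₁ hX₃ hc₁ hc₃.ge (fun s hs => l₁ s hs t ht)
      (fun s hs => l₃ s hs t (by linarith))
      (fun s hs hs' => (g₁ s hs T₁ le_rfl).not_gt (l₃ s hs' T₁ h12.le))
  have c₂ : r < (negAt X a b T₂).card :=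
    big G₂ G₃ T₂ hX₂ hX₃ hc₂.ge hc₃.ge (fun s hs => g₂ s hs T₂ le_rfl)
      (fun s hs => l₃ s hs T₂ le_rfl)
      (fun s hs hs' => (l₂ s hs T₁ le_rfl).not_gt (l₃ s hs' T₁ h12.le))
  have c₄ : ∀ t, T₄ ≤ t → r < (negAt X a b t).card := fun t ht =>
    big G₂ G₄ t hX₂ hX₄ hc₂.ge hc₄ (fun s hs => g₂ s hs t (by linarith))
      (fun s hs => g₄ s hs t ht)
      (fun s hs hs' => (l₄ s hs' T₂ h23.le).not_gt (g₂ s hs T₂ le_rfl))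
  have c₁ : (negAt X a b T₁).card < r := small G₃ T₁ hc₃ fun s hs => by
    rw [mem_negAt] at hs
    rcases (hX s).mp hs.1 with k | k | k | k | k
    · exact absurd hs.2 (g₁ s k T₁ le_rfl).not_gt
    · exact absurd hs.2 (l₂ s k T₁ le_rfl).not_gt
    · exact Or.inl k
    · exact absurd hs.2 (l₄ s k T₁ (by linarith)).not_gt
    · exact Or.inr k
  have c₃ : (negAt X a b T₃).card < r := small G₂ T₃ hc₂ fun s hs => by
    rw [mem_negAt] at hs
    rcases (hX s).mp hs.1 with k | k | k | k | k
    · exact absurd hs.2 (g₁ s k T₃ (by linarith)).not_gt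
    · exact Or.inl k
    · exact absurd hs.2 (g₃ s k T₃ le_rfl).not_gt
    · exact absurd hs.2 (l₄ s k T₃ le_rfl).not_gt
    · exact Or.inr k
  -- One set of cardinality `r` for each of the four intervals.
  obtain ⟨t₁, i1, i2, i3, i4, i5, i6, i7⟩ := exists_unique_negAt_of_leave X G₁ a b h01 hX₁ hG₁
    (fun s hs hs' => by
      rcases (hX s).mp hs with k | k | k | k | k
      · exact absurd k hs'
      · exact Or.inr ⟨l₂ s k _ (by linarith), l₂ s k _ (by linarith)⟩
      · exact Or.inl ⟨l₃ s k _ (by linarith), l₃ s k _ (by linarith)⟩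
      · exact Or.inr ⟨l₄ s k _ (by linarith), l₄ s k _ (by linarith)⟩
      · exact gO s k _ _ (by linarith) (by linarith) (by linarith) (by linarith))
    hroot c₁ (c₀ T₀ le_rfl)
  obtain ⟨t₂, j1, j2, j3, j4, j5, j6, j7⟩ := exists_unique_negAt_of_enter X G₂ a b h12 hX₂ hG₂
    (fun s hs hs' => by
      rcases (hX s).mp hs with k | k | k | k | k
      · exact Or.inr ⟨g₁ s k _ (by linarith), g₁ s k _ (by linarith)⟩
      · exact absurd k hs'
      · exact Or.inl ⟨l₃ s k _ (by linarith), l₃ s k _ (by linarith)⟩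
      · exact Or.inr ⟨l₄ s k _ (by linarith), l₄ s k _ (by linarith)⟩
      · exact gO s k _ _ (by linarith) (by linarith) (by linarith) (by linarith))
    hroot c₁ c₂
  obtain ⟨t₃, k1, k2, k3, k4, k5, k6, k7⟩ := exists_unique_negAt_of_leave X G₃ a b h23 hX₃ hG₃
    (fun s hs hs' => by
      rcases (hX s).mp hs with k | k | k | k | k
      · exact Or.inr ⟨g₁ s k _ (by linarith), g₁ s k _ (by linarith)⟩
      · exact Or.inl ⟨g₂ s k _ (by linarith), g₂ s k _ (by linarith)⟩
      · exact absurd k hs'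
      · exact Or.inr ⟨l₄ s k _ (by linarith), l₄ s k _ (by linarith)⟩
      · exact gO s k _ _ (by linarith) (by linarith) (by linarith) (by linarith))
    hroot c₃ c₂
  obtain ⟨t₄, m1, m2, m3, m4, m5, m6, m7⟩ := exists_unique_negAt_of_enter X G₄ a b h34 hX₄ hG₄
    (fun s hs hs' => by
      rcases (hX s).mp hs with k | k | k | k | k
      · exact Or.inr ⟨g₁ s k _ (by linarith), g₁ s k _ (by linarith)⟩
      · exact Or.inl ⟨g₂ s k _ (by linarith), g₂ s k _ (by linarith)⟩
      · exact Or.inr ⟨g₃ s k _ (by linarith), g₃ s k _ (by linarith)⟩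
      · exact absurd k hs'
      · exact gO s k _ _ (by linarith) (by linarith) (by linarith) (by linarith))
    hroot c₃ (c₄ T₄ le_rfl)
  have hset : {I : Finset α | ∃ t, (∀ s ∈ X, a s + b s * t ≠ 0) ∧ I = negAt X a b t ∧
      I.card = r} = ((({negAt X a b t₁, negAt X a b t₂, negAt X a b t₃,
        negAt X a b t₄} : Finset (Finset α))) : Set (Finset α)) := by
    ext I
    simp only [Set.mem_ofPred_eq, Finset.coe_insert, Finset.coe_singleton, Set.mem_insert_iff,
      Set.mem_singleton_iff]
    constructor
    · rintro ⟨t, -, rfl, hr⟩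
      rcases le_total t T₀ with q₀ | q₀
      · have := c₀ t q₀; omega
      rcases le_total t T₁ with q₁ | q₁
      · exact Or.inl (i7 t q₀ q₁ hr)
      rcases le_total t T₂ with q₂ | q₂
      · exact Or.inr (Or.inl (j7 t q₁ q₂ hr))
      rcases le_total t T₃ with q₃ | q₃
      · exact Or.inr (Or.inr (Or.inl (k7 t q₂ q₃ hr)))
      rcases le_total t T₄ with q₄ | q₄
      · exact Or.inr (Or.inr (Or.inr (m7 t q₃ q₄ hr)))
      · have := c₄ t q₄; omega
    · rintro (rfl | rfl | rfl | rfl)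
      exacts [⟨t₁, i3, rfl, i4⟩, ⟨t₂, j3, rfl, j4⟩, ⟨t₃, k3, rfl, k4⟩, ⟨t₄, m3, rfl, m4⟩]
  -- The four sets differ: the set of an interval splits the group of that interval, and contains
  -- all or nothing of each other group.
  obtain ⟨x₁, hx₁, hx₁'⟩ := i5
  obtain ⟨x₂, hx₂, hx₂'⟩ := j5
  obtain ⟨y₂, hy₂, hy₂'⟩ := j6
  obtain ⟨y₃, hy₃, hy₃'⟩ := k6
  obtain ⟨x₄, hx₄, hx₄'⟩ := m5
  have d₁ : ∀ t, T₁ ≤ t → negAt X a b t₁ ≠ negAt X a b t := fun t ht he =>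
    (g₁ x₁ hx₁ t ht).not_gt (mem_negAt.mp (he ▸ hx₁')).2
  have d₂ : ∀ t, T₂ ≤ t → negAt X a b t₂ ≠ negAt X a b t := fun t ht he =>
    hy₂' (he ▸ mem_negAt.mpr ⟨hX₂ hy₂, g₂ y₂ hy₂ t ht⟩)
  have d₃ : negAt X a b t₃ ≠ negAt X a b t₄ := fun he =>
    (l₄ x₄ hx₄ t₃ k2).not_gt (mem_negAt.mp (he ▸ hx₄')).2
  rw [hset, Set.ncard_coe_finset, Finset.card_insert_of_notMem, Finset.card_insert_of_notMem,
    Finset.card_pair d₃]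
  · simp only [Finset.mem_insert, Finset.mem_singleton, not_or]
    exact ⟨d₂ t₃ k1, d₂ t₄ (by linarith)⟩
  · simp only [Finset.mem_insert, Finset.mem_singleton, not_or]
    exact ⟨d₁ t₂ j1, d₁ t₃ (by linarith), d₁ t₄ (by linarith)⟩

/-! ### Edges of the Voronoi diagram on a bisector -/

/-- The point of the perpendicular bisector of `0` and `q` with parameter `t`. -/
noncomputable def bisectorPoint (q : Plane) (t : ℝ) : Plane :=
  !₂[q 0 / 2 + t * q 1, q 1 / 2 - t * q 0]

/-- The constant coefficient of the power of `s` with respect to the circle through `0` and `q`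
centred at `bisectorPoint q t`, an affine function of `t`. -/
def powerConst (q s : Plane) : ℝ := s 0 ^ 2 + s 1 ^ 2 - q 0 * s 0 - q 1 * s 1

/-- The slope of the power of `s` with respect to the circle through `0` and `q` centred at
`bisectorPoint q t`, an affine function of `t`. -/
def powerSlope (q s : Plane) : ℝ := -2 * (q 1 * s 0 - q 0 * s 1)

lemma sq_dist_eq (x y : Plane) : dist x y ^ 2 = (x 0 - y 0) ^ 2 + (x 1 - y 1) ^ 2 := by
  rw [EuclideanSpace.dist_eq, Real.sq_sqrt (by positivity), Fin.sum_univ_two, Real.dist_eq,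
    Real.dist_eq, sq_abs, sq_abs]

lemma power_eq (q s : Plane) (t : ℝ) : powerConst q s + powerSlope q s * t =
    dist (bisectorPoint q t) s ^ 2 - dist (bisectorPoint q t) 0 ^ 2 := by
  simp only [sq_dist_eq, bisectorPoint, powerConst, powerSlope]
  simp
  ring

lemma power_nonpos_iff (q s : Plane) (t : ℝ) : powerConst q s + powerSlope q s * t ≤ 0 ↔
    dist (bisectorPoint q t) s ≤ dist (bisectorPoint q t) 0 := by
  rw [power_eq, sub_nonpos, sq_le_sq₀ dist_nonneg dist_nonneg]

lemma power_nonneg_iff (q s : Plane) (t : ℝ) : 0 ≤ powerConst q s + powerSlope q s * t ↔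
    dist (bisectorPoint q t) 0 ≤ dist (bisectorPoint q t) s := by
  rw [power_eq, sub_nonneg, sq_le_sq₀ dist_nonneg dist_nonneg]

lemma power_eq_zero_iff (q s : Plane) (t : ℝ) : powerConst q s + powerSlope q s * t = 0 ↔
    dist (bisectorPoint q t) s = dist (bisectorPoint q t) 0 := by
  rw [power_eq, sub_eq_zero, sq_eq_sq₀ dist_nonneg dist_nonneg]

lemma dist_bisectorPoint_self (q : Plane) (t : ℝ) :
    dist (bisectorPoint q t) q = dist (bisectorPoint q t) 0 := by
  rw [← power_eq_zero_iff, powerConst, powerSlope]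
  ring

lemma normSq_pos {q : Plane} (hq : q ≠ 0) : 0 < q 0 ^ 2 + q 1 ^ 2 := by
  have h := sq_dist_eq q 0
  simp only [PiLp.zero_apply, sub_zero] at h
  rw [← h]
  exact pow_pos (dist_pos.mpr hq) 2

lemma mem_perpBisector_zero_iff {q : Plane} (hq : q ≠ 0) (x : Plane) :
    x ∈ AffineSubspace.perpBisector 0 q ↔ ∃ t, bisectorPoint q t = x := by
  rw [AffineSubspace.mem_perpBisector_iff_dist_eq]
  constructor
  · intro h
    have h2 : dist x 0 ^ 2 = dist x q ^ 2 := by rw [h]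
    simp only [sq_dist_eq, PiLp.zero_apply, sub_zero] at h2
    have hn := (normSq_pos hq).ne'
    refine ⟨(x 0 * q 1 - x 1 * q 0) / (q 0 ^ 2 + q 1 ^ 2), ?_⟩
    ext i
    fin_cases i
    · simp only [bisectorPoint]
      simp
      field_simp
      linear_combination -q 0 * h2
    · simp only [bisectorPoint]
      simp
      field_simp
      linear_combination -q 1 * h2
  · rintro ⟨t, rfl⟩
    exact (dist_bisectorPoint_self q t).symm

lemma bisectorPoint_injective {q : Plane} (hq : q ≠ 0) : Function.Injective (bisectorPoint q) := by
  intro t t' h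
  have h0 := congrArg (fun x : Plane => x 0) h
  have h1 := congrArg (fun x : Plane => x 1) h
  simp [bisectorPoint] at h0 h1
  have hn := normSq_pos hq
  have : (t - t') * (q 0 ^ 2 + q 1 ^ 2) = 0 := by
    rcases h0 with h0 | h0 <;> rcases h1 with h1 | h1 <;> simp [h0, h1]
  rcases mul_eq_zero.mp this with h | h
  · linarith
  · exact absurd h hn.ne'

/-- A point with the same distance as `0` to every point of the bisector of `0` and `q` is `0` or
its mirror image `q`. -/
lemma eq_zero_or_eq_of_dist_bisectorPoint_eq {q d : Plane}
    (h : ∀ t, dist (bisectorPoint q t) d = dist (bisectorPoint q t) 0) : d = 0 ∨ d = q := by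
  have e0 := (power_eq_zero_iff q d 0).mpr (h 0)
  have e1 := (power_eq_zero_iff q d 1).mpr (h 1)
  simp only [powerConst, powerSlope] at e0 e1
  have hdet : q 1 * d 0 - q 0 * d 1 = 0 := by linarith
  -- `|d|² |d - q|² = (|d|² - ⟨q, d⟩)² + (q × d)²`, and both squares vanish.
  have hk : (d 0 ^ 2 + d 1 ^ 2) * ((d 0 - q 0) ^ 2 + (d 1 - q 1) ^ 2) = 0 := by
    linear_combination (d 0 ^ 2 + d 1 ^ 2 - q 0 * d 0 - q 1 * d 1) * e0 +
      (q 1 * d 0 - q 0 * d 1) * hdet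
  rcases mul_eq_zero.mp hk with h | h
  · left
    by_contra hd
    exact (normSq_pos hd).ne' h
  · right
    rw [← sq_dist_eq] at h
    exact dist_eq_zero.mp (pow_eq_zero_iff two_ne_zero |>.mp h)

lemma perpBisector_zero_injOn :
    Set.InjOn (AffineSubspace.perpBisector (0 : Plane)) {q | q ≠ 0} := by
  intro q hq q' (hq' : q' ≠ 0) h
  refine ((eq_zero_or_eq_of_dist_bisectorPoint_eq fun t => ?_).resolve_left hq').symm
  have : bisectorPoint q t ∈ AffineSubspace.perpBisector 0 q' :=
    h ▸ (mem_perpBisector_zero_iff hq _).mpr ⟨t, rfl⟩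
  exact (AffineSubspace.mem_perpBisector_iff_dist_eq.mp this).symm

section GeneralPosition

variable {S : Finset Plane} {q : Plane}

lemma InGeneralPosition.powerSlope_ne_zero (hS : InGeneralPosition S) (h0 : 0 ∈ S) (hqS : q ∈ S)
    (hq : q ≠ 0) {s : Plane} (hs : s ∈ S) (hs0 : s ≠ 0) (hsq : s ≠ q) : powerSlope q s ≠ 0 := by
  intro h
  have hd : q 1 * s 0 - q 0 * s 1 = 0 := by
    rw [powerSlope] at h; linarith
  refine hS.1 {0, q, s} ?_ ?_ ?_
  · intro x hx
    simp only [Finset.mem_insert, Finset.mem_singleton] at hx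
    rcases hx with rfl | rfl | rfl <;> assumption
  · rw [Finset.card_eq_three]
    exact ⟨0, q, s, hq.symm, hs0.symm, hsq.symm, rfl⟩
  · rw [collinear_iff_of_mem (p₀ := (0 : Plane)) (by simp)]
    refine ⟨q, fun p hp => ?_⟩
    simp only [Finset.coe_insert, Finset.coe_singleton, Set.mem_insert_iff,
      Set.mem_singleton_iff] at hp
    rcases hp with rfl | rfl | rfl
    · exact ⟨0, by simp⟩
    · exact ⟨1, by simp⟩
    · have hn := (normSq_pos hq).ne'
      refine ⟨(p 0 * q 0 + p 1 * q 1) / (q 0 ^ 2 + q 1 ^ 2), ?_⟩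
      ext i
      fin_cases i
      · simp
        field_simp
        linear_combination q 1 * hd
      · simp
        field_simp
        linear_combination -q 0 * hd

lemma cospherical_of_dist_eq {a b c d x : Plane} (hb : dist x b = dist x a)
    (hc : dist x c = dist x a) (hd : dist x d = dist x a) :
    EuclideanGeometry.Cospherical (({a, b, c, d} : Finset Plane) : Set Plane) := by
  refine ⟨x, dist x a, fun p hp => ?_⟩
  simp only [Finset.coe_insert, Finset.coe_singleton, Set.mem_insert_iff,
    Set.mem_singleton_iff] at hp
  rw [dist_comm]
  rcases hp with rfl | rfl | rfl | rfl <;> first | rfl | assumption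

lemma InGeneralPosition.not_dist_eq (hS : InGeneralPosition S) {a b c d x : Plane} (ha : a ∈ S)
    (hb : b ∈ S) (hc : c ∈ S) (hd : d ∈ S) (hab : a ≠ b) (hac : a ≠ c) (had : a ≠ d) (hbc : b ≠ c)
    (hbd : b ≠ d) (hcd : c ≠ d) (hxb : dist x b = dist x a)
    (hxc : dist x c = dist x a) (hxd : dist x d = dist x a) : False := by
  classical
  refine hS.2 {a, b, c, d} ?_ ?_ (cospherical_of_dist_eq hxb hxc hxd)
  · intro y hy
    simp only [Finset.mem_insert, Finset.mem_singleton] at hy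
    rcases hy with rfl | rfl | rfl | rfl <;> assumption
  · rw [Finset.card_eq_succ]
    refine ⟨a, {b, c, d}, by simp [hab, hac, had], rfl, ?_⟩
    exact Finset.card_eq_three.mpr ⟨b, c, d, hbc, hbd, hcd, rfl⟩

lemma InGeneralPosition.power_root_unique (hS : InGeneralPosition S) (h0 : 0 ∈ S) (hqS : q ∈ S)
    (hq : q ≠ 0) {s s' : Plane} (hs : s ∈ (S.erase 0).erase q) (hs' : s' ∈ (S.erase 0).erase q)
    {t : ℝ} (h : powerConst q s + powerSlope q s * t = 0)
    (h' : powerConst q s' + powerSlope q s' * t = 0) : s = s' := by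
  by_contra hne
  simp only [Finset.mem_erase] at hs hs'
  rw [power_eq_zero_iff] at h h'
  exact hS.not_dist_eq h0 hqS hs.2.2 hs'.2.2 hq.symm hs.2.1.symm hs'.2.1.symm hs.1.symm hs'.1.symm
    hne (dist_bisectorPoint_self q t) h h'

open Classical in
/-- The common boundary of the cells of `insert 0 I` and `insert q I`; every edge on the
perpendicular bisector of `0` and `q` is of this form. -/
noncomputable def bisectorEdge (S : Finset Plane) (q : Plane) (I : Finset Plane) : Set Plane :=
  voronoiCell S (insert 0 I) ∩ voronoiCell S (insert q I)

lemma mem_bisectorEdge_iff (h0 : 0 ∈ S) (hqS : q ∈ S) (hq : q ≠ 0) {I : Finset Plane}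
    (hI : I ⊆ (S.erase 0).erase q) (x : Plane) :
    x ∈ bisectorEdge S q I ↔ ∃ t, bisectorPoint q t = x ∧
      (∀ s ∈ I, powerConst q s + powerSlope q s * t ≤ 0) ∧
      ∀ s ∈ (S.erase 0).erase q, s ∉ I → 0 ≤ powerConst q s + powerSlope q s * t := by
  have h0I : (0 : Plane) ∉ I := fun h => by simpa using hI h
  have hqI : q ∉ I := fun h => by simpa using hI h
  constructor
  · rintro ⟨h1, h2⟩
    have e1 := h1 0 (by simp) q hqS (by simp [hq, hqI])
    have e2 := h2 q (by simp) 0 h0 (by simp [hq.symm, h0I])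
    obtain ⟨t, rfl⟩ := (mem_perpBisector_zero_iff hq x).mp
      (AffineSubspace.mem_perpBisector_iff_dist_eq.mpr (le_antisymm e1 e2))
    refine ⟨t, rfl, fun s hs => ?_, fun s hs hsI => ?_⟩
    · rw [power_nonpos_iff]
      exact h2 s (by simp [hs]) 0 h0 (by simp [hq.symm, h0I])
    · simp only [Finset.mem_erase] at hs
      rw [power_nonneg_iff]
      exact h1 0 (by simp) s hs.2.2 (by simp [hs.2.1, hsI])
  · rintro ⟨t, rfl, h1, h2⟩
    have hself := dist_bisectorPoint_self q t
    have ub : ∀ s ∈ I, dist (bisectorPoint q t) s ≤ dist (bisectorPoint q t) 0 := fun s hs =>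
      (power_nonpos_iff q s t).mp (h1 s hs)
    have lb : ∀ s ∈ S, s ∉ I → dist (bisectorPoint q t) 0 ≤ dist (bisectorPoint q t) s := by
      intro s hs hsI
      by_cases hs0 : s = 0
      · rw [hs0]
      by_cases hsq : s = q
      · rw [hsq, hself]
      exact (power_nonneg_iff q s t).mp (h2 s (by simp [hs0, hsq, hs]) hsI)
    constructor
    · intro a ha s hs hsI
      rw [Finset.mem_insert, not_or] at hsI
      rcases Finset.mem_insert.mp ha with rfl | ha
      · exact lb s hs hsI.2
      · exact (ub a ha).trans (lb s hs hsI.2)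
    · intro a ha s hs hsI
      rw [Finset.mem_insert, not_or] at hsI
      rcases Finset.mem_insert.mp ha with rfl | ha
      · exact hself.le.trans (lb s hs hsI.2)
      · exact (ub a ha).trans (lb s hs hsI.2)

/-- Two cells of the same order whose common boundary is an edge on the perpendicular bisector of
`0` and `q` belong to sets that differ in exchanging `0` and `q`. -/
lemma InGeneralPosition.exists_eq_bisectorEdge (hS : InGeneralPosition S) (h0 : 0 ∈ S)
    (hqS : q ∈ S) (hq : q ≠ 0) {A B : Finset Plane} (hA : A ⊆ S) (hB : B ⊆ S)
    (hcard : A.card = B.card) (hAB : A ≠ B) (hne : (voronoiCell S A ∩ voronoiCell S B).Nontrivial)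
    (hl : voronoiCell S A ∩ voronoiCell S B ⊆ (AffineSubspace.perpBisector 0 q : Set Plane)) :
    ∃ I ⊆ (S.erase 0).erase q, I.card + 1 = A.card ∧
      voronoiCell S A ∩ voronoiCell S B = bisectorEdge S q I := by
  classical
  have hsd : (A \ B).card = (B \ A).card := Finset.card_sdiff_comm hcard
  have heq : ∀ x ∈ voronoiCell S A ∩ voronoiCell S B, ∀ a ∈ A \ B, ∀ b ∈ B \ A,
      dist x a = dist x b := by
    rintro x ⟨hx, hx'⟩ a ha b hb
    rw [Finset.mem_sdiff] at ha hb
    exact le_antisymm (hx a ha.1 b (hB hb.1) hb.2) (hx' b hb.1 a (hA ha.1) ha.2)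
  obtain ⟨x, hx, y, hy, hxy⟩ := hne
  have hpos : 0 < (A \ B).card := by
    rw [Finset.card_pos, Finset.nonempty_iff_ne_empty, Ne, Finset.sdiff_eq_empty_iff_subset]
    exact fun h => hAB (Finset.eq_of_subset_of_card_le h hcard.ge)
  have hone : (A \ B).card = 1 := by
    by_contra h1
    obtain ⟨a, ha, a', ha', haa⟩ := Finset.one_lt_card.mp (show 1 < (A \ B).card by omega)
    obtain ⟨b, hb, b', hb', hbb⟩ := Finset.one_lt_card.mp (show 1 < (B \ A).card by omega)
    have hx1 := heq x hx a ha b hb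
    have hx2 := heq x hx a ha b' hb'
    have hx3 := heq x hx a' ha' b hb
    rw [Finset.mem_sdiff] at ha ha' hb hb'
    refine hS.not_dist_eq (hA ha.1) (hA ha'.1) (hB hb.1) (hB hb'.1) haa
      (ne_of_mem_of_not_mem ha.1 hb.2) (ne_of_mem_of_not_mem ha.1 hb'.2)
      (ne_of_mem_of_not_mem ha'.1 hb.2) (ne_of_mem_of_not_mem ha'.1 hb'.2) hbb
      (x := x) (by rw [hx3, hx1]) hx1.symm hx2.symm
  obtain ⟨a, ha⟩ := Finset.card_eq_one.mp hone
  obtain ⟨b, hb⟩ := Finset.card_eq_one.mp (hsd ▸ hone)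
  have haAB : a ∈ A \ B := by simp [ha]
  have hbBA : b ∈ B \ A := by simp [hb]
  have hA' : A = insert a (A ∩ B) := by
    rw [Finset.insert_eq, ← ha, Finset.sdiff_union_inter]
  have hB' : B = insert b (A ∩ B) := by
    rw [Finset.insert_eq, ← hb, Finset.inter_comm, Finset.sdiff_union_inter]
  have haS := Finset.mem_sdiff.mp haAB
  have hbS := Finset.mem_sdiff.mp hbBA
  have hane : a ≠ b := ne_of_mem_of_not_mem haS.1 hbS.2
  -- Two points of the bisector are equidistant from `a` and `b`, hence all of them are.
  have hall : ∀ t, dist (bisectorPoint q t) a = dist (bisectorPoint q t) b := by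
    obtain ⟨t, ht⟩ := (mem_perpBisector_zero_iff hq x).mp (hl hx)
    obtain ⟨t', ht'⟩ := (mem_perpBisector_zero_iff hq y).mp (hl hy)
    have htt : t - t' ≠ 0 := fun h => hxy (by rw [← ht, ← ht', sub_eq_zero.mp h])
    have h1 := heq x hx a haAB b hbBA
    have h2 := heq y hy a haAB b hbBA
    rw [← ht] at h1
    rw [← ht'] at h2
    have p1 := power_eq q a t
    have p2 := power_eq q b t
    have p3 := power_eq q a t'
    have p4 := power_eq q b t'
    rw [h1] at p1
    rw [h2] at p3
    have hs : powerSlope q a = powerSlope q b := by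
      have : (powerSlope q a - powerSlope q b) * (t - t') = 0 := by linarith
      rcases mul_eq_zero.mp this with h | h
      · linarith
      · exact absurd h htt
    have hc : powerConst q a = powerConst q b := by
      rw [hs] at p1; linarith
    intro u
    have p5 := power_eq q a u
    have p6 := power_eq q b u
    rw [hs, hc] at p5
    have : dist (bisectorPoint q u) a ^ 2 = dist (bisectorPoint q u) b ^ 2 := by linarith
    rwa [sq_eq_sq₀ dist_nonneg dist_nonneg] at this
  -- If neither `a` nor `b` were among `0` and `q`, these four points would be cocircular.
  have huniq : ∀ c ∈ S, ∀ d ∈ S, c ≠ d →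
      (∀ t, dist (bisectorPoint q t) c = dist (bisectorPoint q t) d) → c ≠ 0 → c ≠ q →
      d ≠ 0 → d ≠ q → False := by
    intro c hc d hd hcd h hc0 hcq hd0 hdq
    have hs := hS.powerSlope_ne_zero h0 hqS hq hc hc0 hcq
    have hr : powerConst q c + powerSlope q c * (-powerConst q c / powerSlope q c) = 0 := by
      field_simp; ring
    exact hcd (hS.power_root_unique h0 hqS hq (by simp [hc, hc0, hcq]) (by simp [hd, hd0, hdq])
      hr (by rw [power_eq_zero_iff] at hr ⊢; rw [← h]; exact hr))
  have hcase : (a = 0 ∧ b = q) ∨ (a = q ∧ b = 0) := by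
    by_cases ha0 : a = 0
    · left
      refine ⟨ha0, (eq_zero_or_eq_of_dist_bisectorPoint_eq fun t => by rw [← hall t, ha0]).resolve_left fun h => ?_⟩
      exact hane (ha0.trans h.symm)
    by_cases haq : a = q
    · right
      refine ⟨haq, (eq_zero_or_eq_of_dist_bisectorPoint_eq fun t => ?_).resolve_right fun h => hane (haq.trans h.symm)⟩
      rw [← hall t, haq, dist_bisectorPoint_self]
    by_cases hb0 : b = 0
    · rcases eq_zero_or_eq_of_dist_bisectorPoint_eq fun t => by rw [hall t, hb0] with h | h
      exacts [absurd h ha0, absurd h haq]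
    by_cases hbq : b = q
    · rcases eq_zero_or_eq_of_dist_bisectorPoint_eq fun t => by rw [hall t, hbq, dist_bisectorPoint_self] with h | h
      exacts [absurd h ha0, absurd h haq]
    exact (huniq a (hA haS.1) b (hB hbS.1) hane hall ha0 haq hb0 hbq).elim
  refine ⟨A ∩ B, ?_, ?_, ?_⟩
  · intro s hs
    rw [Finset.mem_inter] at hs
    have hsa : s ≠ a := ne_of_mem_of_not_mem hs.2 haS.2
    have hsb : s ≠ b := ne_of_mem_of_not_mem hs.1 hbS.2
    rcases hcase with ⟨rfl, rfl⟩ | ⟨rfl, rfl⟩ <;> simp [hsa, hsb, hA hs.1]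
  · conv_rhs => rw [hA']
    rw [Finset.card_insert_of_notMem]
    exact fun h => haS.2 (Finset.mem_inter.mp h).2
  · rw [bisectorEdge]
    rcases hcase with ⟨rfl, rfl⟩ | ⟨rfl, rfl⟩
    · rw [← hA', ← hB']
    · rw [← hA', ← hB', Set.inter_comm]

/-- The edges of order `k` on the perpendicular bisector of `0` and `q` correspond to the sets of
`k - 1` points of `S` that lie inside some circle that passes through `0` and `q` and no other point
of `S`. Here `r = k - 1`. -/
lemma InGeneralPosition.edgesOnLine_eq (hS : InGeneralPosition S) (h0 : 0 ∈ S) (hqS : q ∈ S)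
    (hq : q ≠ 0) (r : ℕ) :
    edgesOnLine S (r + 1) (AffineSubspace.perpBisector 0 q) =
      {I : Finset Plane | ∃ t, (∀ s ∈ (S.erase 0).erase q,
        powerConst q s + powerSlope q s * t ≠ 0) ∧
        I = negAt ((S.erase 0).erase q) (powerConst q) (powerSlope q) t ∧ I.card = r}.ncard := by
  classical
  set X := (S.erase 0).erase q with hXdef
  have hXS : X ⊆ S := (Finset.erase_subset _ _).trans (Finset.erase_subset _ _)
  have h0X : (0 : Plane) ∉ X := by simp [hXdef]
  have hqX : q ∉ X := by simp [hXdef]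
  have hneg : ∀ t, negAt X (powerConst q) (powerSlope q) t ⊆ X := fun t => Finset.filter_subset _ _
  rw [edgesOnLine]
  symm
  have himage : {e : Set Plane | IsVoronoiEdge S (r + 1) e ∧
      e ⊆ (AffineSubspace.perpBisector 0 q : Set Plane)} = bisectorEdge S q ''
      {I : Finset Plane | ∃ t, (∀ s ∈ X, powerConst q s + powerSlope q s * t ≠ 0) ∧
        I = negAt X (powerConst q) (powerSlope q) t ∧ I.card = r} := by
    ext e
    constructor
    · rintro ⟨⟨A, B, hA, hB, hcA, hcB, hAB, rfl, hne⟩, hl⟩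
      obtain ⟨I, hI, hcard, he⟩ := hS.exists_eq_bisectorEdge h0 hqS hq hA hB (hcA.trans hcB.symm)
        hAB hne hl
      rw [he] at hne ⊢
      refine ⟨I, ?_, rfl⟩
      obtain ⟨x, hx, y, hy, hxy⟩ := hne
      obtain ⟨t, rfl, ht1, ht2⟩ := (mem_bisectorEdge_iff h0 hqS hq hI x).mp hx
      obtain ⟨t', rfl, ht1', ht2'⟩ := (mem_bisectorEdge_iff h0 hqS hq hI y).mp hy
      have htt : t ≠ t' := fun h => hxy (by rw [h])
      -- Only finitely many parameters belong to circles through a third point of `S`.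
      obtain ⟨u, hu, huX⟩ := (Set.Ioo_infinite (min_lt_max.mpr htt)).exists_notMem_finset
        (X.image fun s => -powerConst q s / powerSlope q s)
      have hgen : ∀ s ∈ X, powerConst q s + powerSlope q s * u ≠ 0 := by
        intro s hs h
        apply huX
        rw [Finset.mem_image]
        refine ⟨s, hs, ?_⟩
        have hs' := hs
        simp only [hXdef, Finset.mem_erase] at hs'
        have := hS.powerSlope_ne_zero h0 hqS hq hs'.2.2 hs'.2.1 hs'.1
        rw [div_eq_iff this]
        linarith
      have hbetween : ∀ s, (powerSlope q s * t ≤ powerSlope q s * u ∧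
          powerSlope q s * u ≤ powerSlope q s * t') ∨ (powerSlope q s * t' ≤ powerSlope q s * u ∧
          powerSlope q s * u ≤ powerSlope q s * t) := by
        intro s
        rcases le_total t t' with h | h <;> rcases le_total 0 (powerSlope q s) with k | k <;>
          simp only [h, min_eq_left, max_eq_right, min_eq_right, max_eq_left, Set.mem_Ioo] at hu
        · exact Or.inl ⟨mul_le_mul_of_nonneg_left hu.1.le k, mul_le_mul_of_nonneg_left hu.2.le k⟩
        · exact Or.inr ⟨mul_le_mul_of_nonpos_left hu.2.le k, mul_le_mul_of_nonpos_left hu.1.le k⟩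
        · exact Or.inr ⟨mul_le_mul_of_nonneg_left hu.1.le k, mul_le_mul_of_nonneg_left hu.2.le k⟩
        · exact Or.inl ⟨mul_le_mul_of_nonpos_left hu.2.le k, mul_le_mul_of_nonpos_left hu.1.le k⟩
      refine ⟨u, hgen, ?_, by omega⟩
      ext s
      rw [mem_negAt]
      constructor
      · intro hs
        refine ⟨hI hs, lt_of_le_of_ne ?_ (hgen s (hI hs))⟩
        have := ht1 s hs
        have := ht1' s hs
        rcases hbetween s with h | h <;> linarith
      · rintro ⟨hsX, hs⟩
        by_contra hsI
        have := ht2 s hsX hsI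
        have := ht2' s hsX hsI
        rcases hbetween s with h | h <;> linarith
    · rintro ⟨I, ⟨t, ht, hI, hcard⟩, rfl⟩
      have hIX : I ⊆ X := hI ▸ hneg t
      refine ⟨⟨insert 0 I, insert q I, ?_, ?_, ?_, ?_, ?_, rfl, ?_⟩, ?_⟩
      · exact Finset.insert_subset h0 (hIX.trans hXS)
      · exact Finset.insert_subset hqS (hIX.trans hXS)
      · rw [Finset.card_insert_of_notMem fun h => h0X (hIX h), hcard]
      · rw [Finset.card_insert_of_notMem fun h => hqX (hIX h), hcard]
      · intro h
        have : (0 : Plane) ∈ insert q I := h ▸ Finset.mem_insert_self 0 I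
        rcases Finset.mem_insert.mp this with h | h
        · exact hq h.symm
        · exact h0X (hIX h)
      · -- The sign conditions at `t` persist in a neighbourhood of `t`.
        have hev : ∀ᶠ u in nhds t, ∀ s ∈ X,
            (s ∈ I → powerConst q s + powerSlope q s * u ≤ 0) ∧
            (s ∉ I → 0 ≤ powerConst q s + powerSlope q s * u) := by
          rw [Filter.eventually_all_finset]
          intro s hs
          have hcont : Continuous fun u => powerConst q s + powerSlope q s * u := by fun_prop
          rcases lt_or_gt_of_ne (ht s hs) with h | h
          · filter_upwards [hcont.continuousAt.eventually (gt_mem_nhds h)] with u hu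
            refine ⟨fun _ => hu.le, fun hsI => absurd ?_ hsI⟩
            rw [hI, mem_negAt]
            exact ⟨hs, h⟩
          · filter_upwards [hcont.continuousAt.eventually (lt_mem_nhds h)] with u hu
            refine ⟨fun hsI => absurd ?_ h.not_gt, fun _ => hu.le⟩
            rw [hI, mem_negAt] at hsI
            exact hsI.2
        have hmem : ∀ u, (∀ s ∈ X,
            (s ∈ I → powerConst q s + powerSlope q s * u ≤ 0) ∧
            (s ∉ I → 0 ≤ powerConst q s + powerSlope q s * u)) →
            bisectorPoint q u ∈ bisectorEdge S q I := fun u hu =>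
          (mem_bisectorEdge_iff h0 hqS hq hIX _).mpr
            ⟨u, rfl, fun s hs => (hu s (hIX hs)).1 hs, fun s hs => (hu s hs).2⟩
        obtain ⟨u, hu, hut⟩ := ((hev.filter_mono nhdsWithin_le_nhds).and
          (eventually_mem_nhdsWithin : ∀ᶠ u in nhdsWithin t (Set.Ioi t), u ∈ Set.Ioi t)).exists
        exact ⟨_, hmem t hev.self_of_nhds, _, hmem u hu,
          (bisectorPoint_injective hq).ne (ne_of_lt hut)⟩
      · intro x hx
        obtain ⟨u, rfl, -⟩ := (mem_bisectorEdge_iff h0 hqS hq hIX x).mp hx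
        exact (mem_perpBisector_zero_iff hq _).mpr ⟨u, rfl⟩
  rw [himage]
  refine (Set.InjOn.ncard_image ?_).symm
  rintro I ⟨t, ht, hI, -⟩ J ⟨u, -, hJ, -⟩ hIJ
  have hIX : I ⊆ X := hI ▸ hneg t
  have hJX : J ⊆ X := hJ ▸ hneg u
  have hmem : bisectorPoint q t ∈ bisectorEdge S q I :=
    (mem_bisectorEdge_iff h0 hqS hq hIX _).mpr ⟨t, rfl, fun s hs => by
      rw [hI, mem_negAt] at hs
      exact hs.2.le, fun s hs hsI => by
      rw [hI, mem_negAt] at hsI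
      by_contra! h
      exact hsI ⟨hs, h⟩⟩
  rw [hIJ] at hmem
  obtain ⟨t', ht', h1, h2⟩ := (mem_bisectorEdge_iff h0 hqS hq hJX _).mp hmem
  obtain rfl := bisectorPoint_injective hq ht'
  ext s
  rw [hI, mem_negAt]
  constructor
  · rintro ⟨hs, hlt⟩
    by_contra hsJ
    exact (h2 s hs hsJ).not_gt hlt
  · intro hs
    exact ⟨hJX hs, lt_of_le_of_ne (h1 s hs) (ht s (hJX hs))⟩

end GeneralPosition

/-! ### The configuration -/

/-- The model positions of the partners of the origin: six points on the vertical axis. -/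
noncomputable def partnerCenter (i : Fin 6) : Plane := !₂[0, 2 + (i : ℝ) / 20]

/-- The model position of a group of points: a point with second coordinate `1`. -/
noncomputable def groupCenter (x : ℝ) : Plane := !₂[x, 1]

lemma power_partnerCenter_groupCenter (i : Fin 6) (x T : ℝ) :
    powerConst (partnerCenter i) (groupCenter x) + powerSlope (partnerCenter i) (groupCenter x) * T
      = x ^ 2 + 1 - (2 + (i : ℝ) / 20) - 2 * (2 + (i : ℝ) / 20) * x * T := by
  simp [powerConst, powerSlope, partnerCenter, groupCenter]
  ring

lemma power_partnerCenter_partnerCenter (i j : Fin 6) (T : ℝ) :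
    powerConst (partnerCenter i) (partnerCenter j) +
      powerSlope (partnerCenter i) (partnerCenter j) * T =
      (2 + (j : ℝ) / 20) * (((j : ℝ) - i) / 20) := by
  simp [powerConst, powerSlope, partnerCenter]
  ring

lemma continuous_power (T : ℝ) :
    Continuous fun p : Plane × Plane => powerConst p.1 p.2 + powerSlope p.1 p.2 * T := by
  unfold powerConst powerSlope
  fun_prop

lemma eventually_ball_of_isOpen {V : Set (Plane × Plane)} (hV : IsOpen V) {c g : Plane}
    (h : (c, g) ∈ V) :
    ∀ᶠ ε in nhdsWithin (0 : ℝ) (Set.Ioi 0),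
      ∀ q ∈ Metric.ball c ε, ∀ s ∈ Metric.ball g ε, (q, s) ∈ V := by
  obtain ⟨δ, hδ, hsub⟩ := Metric.isOpen_iff.mp hV _ h
  filter_upwards [Ioo_mem_nhdsGT hδ] with ε hε q hq s hs
  apply hsub
  rw [← ball_prod_same]
  exact ⟨Metric.ball_subset_ball hε.2.le hq, Metric.ball_subset_ball hε.2.le hs⟩

lemma eventually_power_neg {c g : Plane} {T : ℝ} (h : powerConst c g + powerSlope c g * T < 0) :
    ∀ᶠ ε in nhdsWithin (0 : ℝ) (Set.Ioi 0),
      ∀ q ∈ Metric.ball c ε, ∀ s ∈ Metric.ball g ε, powerConst q s + powerSlope q s * T < 0 :=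
  eventually_ball_of_isOpen (isOpen_lt (continuous_power T) continuous_const) h

lemma eventually_power_pos {c g : Plane} {T : ℝ} (h : 0 < powerConst c g + powerSlope c g * T) :
    ∀ᶠ ε in nhdsWithin (0 : ℝ) (Set.Ioi 0),
      ∀ q ∈ Metric.ball c ε, ∀ s ∈ Metric.ball g ε, 0 < powerConst q s + powerSlope q s * T :=
  eventually_ball_of_isOpen (isOpen_lt continuous_const (continuous_power T)) h

/-- Around the model positions there are discs such that, for a partner `q` in its disc, the circles
through `0` and `q` meet the points of the four group discs in the parameter intervals
`(-1, -1/2)`, `(-1/2, 0)`, `(0, 1/2)`, `(1/2, 1)`, and the other partner discs only outside of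
`[-1, 1]`. -/
lemma exists_radius : ∃ ε : ℝ, 0 < ε ∧ ∀ i : Fin 6, ∀ q ∈ Metric.ball (partnerCenter i) ε,
    (∀ s ∈ Metric.ball (groupCenter (-3)) ε, powerConst q s + powerSlope q s * (-1) < 0 ∧
      0 < powerConst q s + powerSlope q s * (-1 / 2)) ∧
    (∀ s ∈ Metric.ball (groupCenter (1 / 2)) ε, 0 < powerConst q s + powerSlope q s * (-1 / 2) ∧
      powerConst q s + powerSlope q s * 0 < 0) ∧
    (∀ s ∈ Metric.ball (groupCenter (-1 / 2)) ε, powerConst q s + powerSlope q s * 0 < 0 ∧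
      0 < powerConst q s + powerSlope q s * (1 / 2)) ∧
    (∀ s ∈ Metric.ball (groupCenter 3) ε, 0 < powerConst q s + powerSlope q s * (1 / 2) ∧
      powerConst q s + powerSlope q s * 1 < 0) ∧
    ∀ j : Fin 6, j ≠ i → ∀ s ∈ Metric.ball (partnerCenter j) ε,
      (powerConst q s + powerSlope q s * (-1) < 0 ∧ powerConst q s + powerSlope q s * 1 < 0) ∨
      (0 < powerConst q s + powerSlope q s * (-1) ∧ 0 < powerConst q s + powerSlope q s * 1) := by
  have hi : ∀ i : Fin 6, (0 : ℝ) ≤ (i : ℝ) ∧ (i : ℝ) ≤ 5 := fun i =>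
    ⟨by positivity, by exact_mod_cast Nat.le_of_lt_succ i.isLt⟩
  have neg : ∀ (x T : ℝ), (∀ i : Fin 6,
      x ^ 2 + 1 - (2 + (i : ℝ) / 20) - 2 * (2 + (i : ℝ) / 20) * x * T < 0) → ∀ i : Fin 6,
      ∀ᶠ ε in nhdsWithin (0 : ℝ) (Set.Ioi 0), ∀ q ∈ Metric.ball (partnerCenter i) ε,
        ∀ s ∈ Metric.ball (groupCenter x) ε, powerConst q s + powerSlope q s * T < 0 :=
    fun x T h i => eventually_power_neg (by rw [power_partnerCenter_groupCenter]; exact h i)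
  have pos : ∀ (x T : ℝ), (∀ i : Fin 6,
      0 < x ^ 2 + 1 - (2 + (i : ℝ) / 20) - 2 * (2 + (i : ℝ) / 20) * x * T) → ∀ i : Fin 6,
      ∀ᶠ ε in nhdsWithin (0 : ℝ) (Set.Ioi 0), ∀ q ∈ Metric.ball (partnerCenter i) ε,
        ∀ s ∈ Metric.ball (groupCenter x) ε, 0 < powerConst q s + powerSlope q s * T :=
    fun x T h i => eventually_power_pos (by rw [power_partnerCenter_groupCenter]; exact h i)
  have other : ∀ i j : Fin 6, ∀ᶠ ε in nhdsWithin (0 : ℝ) (Set.Ioi 0), j ≠ i →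
      ∀ q ∈ Metric.ball (partnerCenter i) ε, ∀ s ∈ Metric.ball (partnerCenter j) ε,
      (powerConst q s + powerSlope q s * (-1) < 0 ∧ powerConst q s + powerSlope q s * 1 < 0) ∨
      (0 < powerConst q s + powerSlope q s * (-1) ∧
        0 < powerConst q s + powerSlope q s * 1) := by
    intro i j
    have hj := hi j
    rcases lt_trichotomy j i with h | h | h
    · have hlt : (j : ℝ) < i := by exact_mod_cast h
      have hc : ∀ T, powerConst (partnerCenter i) (partnerCenter j) +
          powerSlope (partnerCenter i) (partnerCenter j) * T < 0 := fun T => by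
        rw [power_partnerCenter_partnerCenter]
        exact mul_neg_of_pos_of_neg (by linarith) (by linarith)
      filter_upwards [eventually_power_neg (hc (-1)), eventually_power_neg (hc 1)] with ε h1 h2
      exact fun _ q hq s hs => Or.inl ⟨h1 q hq s hs, h2 q hq s hs⟩
    · exact Eventually.of_forall fun ε hne => absurd h hne
    · have hlt : (i : ℝ) < j := by exact_mod_cast h
      have hc : ∀ T, 0 < powerConst (partnerCenter i) (partnerCenter j) +
          powerSlope (partnerCenter i) (partnerCenter j) * T := fun T => by
        rw [power_partnerCenter_partnerCenter]
        exact mul_pos (by linarith) (by linarith)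
      filter_upwards [eventually_power_pos (hc (-1)), eventually_power_pos (hc 1)] with ε h1 h2
      exact fun _ q hq s hs => Or.inr ⟨h1 q hq s hs, h2 q hq s hs⟩
  have hall := (eventually_all.mpr (neg (-3) (-1) fun i => by linarith [hi i])).and <|
    (eventually_all.mpr (pos (-3) (-1 / 2) fun i => by linarith [hi i])).and <|
    (eventually_all.mpr (pos (1 / 2) (-1 / 2) fun i => by linarith [hi i])).and <|
    (eventually_all.mpr (neg (1 / 2) 0 fun i => by linarith [hi i])).and <|
    (eventually_all.mpr (neg (-1 / 2) 0 fun i => by linarith [hi i])).and <|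
    (eventually_all.mpr (pos (-1 / 2) (1 / 2) fun i => by linarith [hi i])).and <|
    (eventually_all.mpr (pos 3 (1 / 2) fun i => by linarith [hi i])).and <|
    (eventually_all.mpr (neg 3 1 fun i => by linarith [hi i])).and <|
    (eventually_all.mpr fun i => eventually_all.mpr (other i)).and
    (eventually_mem_nhdsWithin : ∀ᶠ ε in nhdsWithin (0 : ℝ) (Set.Ioi 0), ε ∈ Set.Ioi (0 : ℝ))
  obtain ⟨ε, h1, h2, h3, h4, h5, h6, h7, h8, h9, h10⟩ := hall.exists
  exact ⟨ε, h10, fun i q hq =>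
    ⟨fun s hs => ⟨h1 i q hq s hs, h2 i q hq s hs⟩, fun s hs => ⟨h3 i q hq s hs, h4 i q hq s hs⟩,
      fun s hs => ⟨h5 i q hq s hs, h6 i q hq s hs⟩, fun s hs => ⟨h7 i q hq s hs, h8 i q hq s hs⟩,
      fun j hj s hs => h9 i j hj q hq s hs⟩⟩

/-- There is a set of `n` points in general position that contains the origin and six further
points such that the six bisectors they form with the origin all contribute four edges to the
diagrams of all orders between `h + 7` and `2 * h`. -/
lemma exists_configuration (n h : ℕ) (hn : 4 * h + 7 ≤ n) :
    ∃ S B : Finset Plane, S.card = n ∧ InGeneralPosition S ∧ 0 ∈ S ∧ B ⊆ S ∧ 0 ∉ B ∧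
      B.card = 6 ∧ ∀ q ∈ B, ∀ k, h + 7 ≤ k → k ≤ 2 * h →
        edgesOnLine S k (AffineSubspace.perpBisector 0 q) = 4 := by
  classical
  obtain ⟨ε, hε, hsign⟩ := exists_radius
  let center : Fin 6 ⊕ Fin h ⊕ Fin h ⊕ Fin h ⊕ Fin (n - 7 - 3 * h) → Plane :=
    Sum.elim partnerCenter <| Sum.elim (fun _ => groupCenter (-3)) <|
      Sum.elim (fun _ => groupCenter (1 / 2)) <| Sum.elim (fun _ => groupCenter (-1 / 2))
        fun _ => groupCenter 3
  obtain ⟨f, hfU, hinj, hf0, hgp⟩ := (inGeneralPosition_singleton 0).exists_extension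
    (fun i => Metric.ball (center i) ε) (fun _ => Metric.isOpen_ball)
    (fun i => ⟨center i, Metric.mem_ball_self hε⟩)
  set S : Finset Plane := {0} ∪ Finset.univ.image f with hSdef
  have hmemS : ∀ i, f i ∈ S := fun i => by simp [hSdef]
  have hf0' : ∀ i, f i ≠ 0 := fun i => by simpa using hf0 i
  have h0S : (0 : Plane) ∈ S := by simp [hSdef]
  have hcardS : S.card = n := by
    rw [hSdef, Finset.card_union_of_disjoint, Finset.card_image_of_injective _ hinj]
    · simp only [Finset.card_singleton, Finset.card_univ, Fintype.card_sum, Fintype.card_fin]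
      omega
    · simpa using hf0'
  have himg : ∀ {m : ℕ} (e : Fin m → Fin 6 ⊕ Fin h ⊕ Fin h ⊕ Fin h ⊕ Fin (n - 7 - 3 * h)),
      Function.Injective e → (Finset.univ.image fun j => f (e j)).card = m := fun e he =>
    (Finset.card_image_of_injective _ (hinj.comp he)).trans (by simp)
  refine ⟨S, Finset.univ.image fun i => f (Sum.inl i), hcardS, hgp, h0S, ?_, ?_,
    himg _ Sum.inl_injective, ?_⟩
  · intro x hx
    obtain ⟨i, -, rfl⟩ := Finset.mem_image.mp hx
    exact hmemS _
  · intro hx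
    obtain ⟨i, -, hi⟩ := Finset.mem_image.mp hx
    exact hf0' _ hi
  · intro q hq k hk1 hk2
    obtain ⟨i, -, rfl⟩ := Finset.mem_image.mp hq
    obtain ⟨r, rfl⟩ : ∃ r, k = r + 1 := ⟨k - 1, by omega⟩
    obtain ⟨s1, s2, s3, s4, s5⟩ := hsign i _ (hfU (Sum.inl i))
    rw [hgp.edgesOnLine_eq h0S (hmemS _) (hf0' _) r]
    have hneq : ∀ j, j ≠ Sum.inl i → f j ∈ (S.erase 0).erase (f (Sum.inl i)) := fun j hj => by
      simp only [Finset.mem_erase]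
      exact ⟨hinj.ne hj, hf0' j, hmemS j⟩
    refine ncard_negAt_eq_four _ _ _
      (Finset.univ.image fun j => f (Sum.inr (Sum.inl j)))
      (Finset.univ.image fun j => f (Sum.inr (Sum.inr (Sum.inl j))))
      (Finset.univ.image fun j => f (Sum.inr (Sum.inr (Sum.inr (Sum.inl j)))))
      (Finset.univ.image fun j => f (Sum.inr (Sum.inr (Sum.inr (Sum.inr j)))))
      ((Finset.univ.erase i).image fun j => f (Sum.inl j))
      (T₀ := -1) (T₁ := -1 / 2) (T₂ := 0) (T₃ := 1 / 2) (T₄ := 1) (h := h) (c := 5)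
      (by norm_num) (by norm_num) (by norm_num) (by norm_num)
      ?_ ?_ ?_ ?_ ?_ ?_ ?_ ?_ ?_ ?_ ?_ ?_ ?_ ?_
    · intro s
      constructor
      · intro hs
        simp only [Finset.mem_erase] at hs
        obtain ⟨hs1, hs2, hs3⟩ := hs
        rw [hSdef, Finset.mem_union, Finset.mem_singleton] at hs3
        obtain ⟨j, -, rfl⟩ := Finset.mem_image.mp (hs3.resolve_left hs2)
        rcases j with j | j | j | j | j
        · have hji : j ≠ i := fun h => hs1 (by rw [h])
          exact Or.inr <| Or.inr <| Or.inr <| Or.inr <|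
            Finset.mem_image.mpr ⟨j, by simp [hji], rfl⟩
        · exact Or.inl <| Finset.mem_image.mpr ⟨j, by simp, rfl⟩
        · exact Or.inr <| Or.inl <| Finset.mem_image.mpr ⟨j, by simp, rfl⟩
        · exact Or.inr <| Or.inr <| Or.inl <| Finset.mem_image.mpr ⟨j, by simp, rfl⟩
        · exact Or.inr <| Or.inr <| Or.inr <| Or.inl <| Finset.mem_image.mpr ⟨j, by simp, rfl⟩
      · rintro (hs | hs | hs | hs | hs) <;> obtain ⟨j, hj, rfl⟩ := Finset.mem_image.mp hs
        · exact hneq _ Sum.inr_ne_inl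
        · exact hneq _ Sum.inr_ne_inl
        · exact hneq _ Sum.inr_ne_inl
        · exact hneq _ Sum.inr_ne_inl
        · exact hneq _ (Sum.inl_injective.ne (Finset.ne_of_mem_erase hj))
    · intro s hs
      obtain ⟨j, -, rfl⟩ := Finset.mem_image.mp hs
      exact s1 _ (hfU (Sum.inr (Sum.inl j)))
    · intro s hs
      obtain ⟨j, -, rfl⟩ := Finset.mem_image.mp hs
      exact s2 _ (hfU (Sum.inr (Sum.inr (Sum.inl j))))
    · intro s hs
      obtain ⟨j, -, rfl⟩ := Finset.mem_image.mp hs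
      exact s3 _ (hfU (Sum.inr (Sum.inr (Sum.inr (Sum.inl j)))))
    · intro s hs
      obtain ⟨j, -, rfl⟩ := Finset.mem_image.mp hs
      exact s4 _ (hfU (Sum.inr (Sum.inr (Sum.inr (Sum.inr j)))))
    · intro s hs
      obtain ⟨j, hj, rfl⟩ := Finset.mem_image.mp hs
      exact s5 j (Finset.ne_of_mem_erase hj) _ (hfU (Sum.inl j))
    · exact fun s hs s' hs' t => hgp.power_root_unique h0S (hmemS _) (hf0' _) hs hs'
    · exact (himg _ (Sum.inr_injective.comp Sum.inl_injective)).ge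
    · exact himg _ (Sum.inr_injective.comp (Sum.inr_injective.comp Sum.inl_injective))
    · exact himg _ (Sum.inr_injective.comp
        (Sum.inr_injective.comp (Sum.inr_injective.comp Sum.inl_injective)))
    · have := himg _ (Sum.inr_injective.comp
        (Sum.inr_injective.comp (Sum.inr_injective.comp Sum.inr_injective)))
      refine le_of_le_of_eq ?_ this.symm
      omega
    · exact Finset.card_image_le.trans (by simp)
    · omega
    · omega

/-! ### Counting bisectors -/

lemma card_le_fourEdgeBisectors {S P B : Finset Plane} {k : ℕ} (h0 : 0 ∈ P) (hBP : B ⊆ P)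
    (hB : 0 ∉ B) (h : ∀ q ∈ B, edgesOnLine S k (AffineSubspace.perpBisector 0 q) = 4) :
    B.card ≤ fourEdgeBisectors S P k := by
  have hB' : ∀ q ∈ B, q ≠ 0 := fun q hq => ne_of_mem_of_not_mem hq hB
  rw [← Set.ncard_coe_finset, fourEdgeBisectors,
    ← (perpBisector_zero_injOn.mono fun q hq => hB' q hq : Set.InjOn _ (B : Set Plane)).ncard_image]
  refine Set.ncard_le_ncard ?_ ?_
  · rintro _ ⟨q, hq, rfl⟩
    exact ⟨⟨0, h0, q, hBP hq, (hB' q hq).symm, rfl⟩, h q hq⟩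
  · refine (Set.Finite.image2 AffineSubspace.perpBisector P.finite_toSet P.finite_toSet).subset ?_
    rintro l ⟨⟨p, hp, q, hq, -, rfl⟩, -⟩
    exact ⟨p, hp, q, hq, rfl⟩

/-- There are no diagrams of order larger than the number of points. -/
lemma fourEdgeBisectors_eq_zero {S P : Finset Plane} {k : ℕ} (hk : S.card < k) :
    fourEdgeBisectors S P k = 0 := by
  have hno : ∀ e, ¬ IsVoronoiEdge S k e := by
    rintro e ⟨A, -, hA, -, hcard, -⟩
    exact (Finset.card_le_card hA).not_gt (hcard ▸ hk)
  simp [fourEdgeBisectors, edgesOnLine, hno]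

/-- The constant `42 = 6 * 7` absorbs the shift by `7` of the range of orders, taken six times, and
the rounding. -/
lemma bounds_of_six_le {S P : Finset Plane} {n : ℕ} (hS : S.card = n) (hn : 42 ≤ n)
    (h : ∀ k, n / 6 + 7 ≤ k → k ≤ 2 * (n / 6) → 6 ≤ fourEdgeBisectors S P k) :
    4 * (n : ℝ) / 7 - 42 ≤ ∑ k ∈ Finset.Icc 1 (2 * n / 7), (fourEdgeBisectors S P k : ℝ) ∧
      (n : ℝ) / 6 - 42 ≤ ({k : ℕ | fourEdgeBisectors S P k ≠ 0}.ncard : ℝ) := by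
  constructor
  · have h1 : ∑ k ∈ Finset.Icc (n / 6 + 7) (2 * n / 7), 6 ≤
        ∑ k ∈ Finset.Icc 1 (2 * n / 7), fourEdgeBisectors S P k :=
      (Finset.sum_le_sum fun k hk => by
        rw [Finset.mem_Icc] at hk
        exact h k hk.1 (by omega)).trans
      (Finset.sum_le_sum_of_subset (Finset.Icc_subset_Icc (by omega) le_rfl))
    rw [Finset.sum_const, Nat.card_Icc, smul_eq_mul] at h1
    have h2 : 4 * n ≤ 7 * (∑ k ∈ Finset.Icc 1 (2 * n / 7), fourEdgeBisectors S P k) + 7 * 42 := by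
      omega
    have h3 : 4 * (n : ℝ) ≤
        7 * (∑ k ∈ Finset.Icc 1 (2 * n / 7), (fourEdgeBisectors S P k : ℝ)) + 7 * 42 := by
      exact_mod_cast h2
    linarith
  · have hsub : ((Finset.Icc (n / 6 + 7) (2 * (n / 6)) : Finset ℕ) : Set ℕ) ⊆
        {k : ℕ | fourEdgeBisectors S P k ≠ 0} := by
      intro k hk
      rw [Finset.coe_Icc, Set.mem_Icc] at hk
      have := h k hk.1 hk.2
      simp only [Set.mem_ofPred_eq]
      omega
    have hfin : {k : ℕ | fourEdgeBisectors S P k ≠ 0}.Finite := by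
      refine (Set.finite_Iic n).subset fun k hk => ?_
      by_contra hcon
      exact hk (fourEdgeBisectors_eq_zero (by simpa [hS] using hcon))
    have h1 := Set.ncard_le_ncard hsub hfin
    rw [Set.ncard_coe_finset, Nat.card_Icc] at h1
    have h2 : n ≤ 6 * {k : ℕ | fourEdgeBisectors S P k ≠ 0}.ncard + 6 * 42 := by omega
    have h3 : (n : ℝ) ≤ 6 * ({k : ℕ | fourEdgeBisectors S P k ≠ 0}.ncard : ℝ) + 6 * 42 := by
      exact_mod_cast h2
    linarith

theorem proposition1 :
    ∃ (C : ℝ) (err : ℕ → ℝ), (err =o[atTop] fun n : ℕ => (n : ℝ)) ∧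
      ∀ n : ℕ, ∃ S : Finset Plane, S.card = n ∧ InGeneralPosition S ∧
        4 * (n : ℝ) / 7 - err n ≤
          ∑ k ∈ Finset.Icc 1 (2 * n / 7), (fourEdgeBisectors S S k : ℝ) ∧
        (n : ℝ) / 6 - err n ≤ ({k : ℕ | fourEdgeBisectors S S k ≠ 0}.ncard : ℝ) ∧
        ∃ P : Finset Plane, P ⊆ S ∧ (P.card : ℝ) ≤ C * Real.log n ∧
          4 * (n : ℝ) / 7 - err n ≤
            ∑ k ∈ Finset.Icc 1 (2 * n / 7), (fourEdgeBisectors S P k : ℝ) ∧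
          (n : ℝ) / 6 - err n ≤ ({k : ℕ | fourEdgeBisectors S P k ≠ 0}.ncard : ℝ) := by
  classical
  have hlog2 : 0 < Real.log 2 := Real.log_pos one_lt_two
  refine ⟨7 / Real.log 2, fun _ => 42, ?_, fun n => ?_⟩
  · exact isLittleO_const_left.mpr <| Or.inr <|
      tendsto_norm_atTop_atTop.comp tendsto_natCast_atTop_atTop
  rcases Nat.lt_or_ge n 42 with hn | hn
  · -- For small `n` both lower bounds are negative.
    obtain ⟨S, hcard, hS⟩ := exists_inGeneralPosition_card n
    have hn' : (n : ℝ) < 42 := by exact_mod_cast hn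
    have hsum : ∀ P : Finset Plane, 4 * (n : ℝ) / 7 - 42 ≤
        ∑ k ∈ Finset.Icc 1 (2 * n / 7), (fourEdgeBisectors S P k : ℝ) := fun P =>
      le_trans (by linarith) (Finset.sum_nonneg fun k _ => Nat.cast_nonneg _)
    have hnum : ∀ P : Finset Plane, (n : ℝ) / 6 - 42 ≤
        ({k : ℕ | fourEdgeBisectors S P k ≠ 0}.ncard : ℝ) := fun P =>
      le_trans (by linarith) (Nat.cast_nonneg _)
    refine ⟨S, hcard, hS, hsum S, hnum S, ∅, Finset.empty_subset S, ?_, hsum ∅, hnum ∅⟩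
    have := Real.log_natCast_nonneg n
    rw [Finset.card_empty, Nat.cast_zero]
    positivity
  · obtain ⟨S, B, hcard, hS, h0, hBS, h0B, hB, hedges⟩ :=
      exists_configuration n (n / 6) (by omega)
    have hsix : ∀ P : Finset Plane, 0 ∈ P → B ⊆ P → ∀ k, n / 6 + 7 ≤ k → k ≤ 2 * (n / 6) →
        6 ≤ fourEdgeBisectors S P k := fun P h0P hBP k hk1 hk2 =>
      hB ▸ card_le_fourEdgeBisectors h0P hBP h0B fun q hq => hedges q hq k hk1 hk2
    obtain ⟨b1, b2⟩ := bounds_of_six_le hcard hn (hsix S h0 hBS)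
    obtain ⟨b3, b4⟩ := bounds_of_six_le hcard hn
      (hsix (insert 0 B) (Finset.mem_insert_self 0 B) (Finset.subset_insert 0 B))
    refine ⟨S, hcard, hS, b1, b2, insert 0 B, Finset.insert_subset h0 hBS, ?_, b3, b4⟩
    rw [Finset.card_insert_of_notMem h0B, hB, div_mul_eq_mul_div, le_div_iff₀ hlog2]
    have : Real.log 2 ≤ Real.log n :=
      Real.log_le_log two_pos (by exact_mod_cast (by omega : 2 ≤ n))
    norm_num
    linarith
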